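/- Let $\mathbb R^3_{\ge 0}$ be the closed nonnegative octant, with coordinates $x_1,x_2,x_3$, and let $S\subset\mathbb R^3_{\ge 0}$ be a finite set which is \emph{axial} (it contains a point on each coordinate axis) and in \emph{general position}: each coordinate plane contains exactly two points of $S$, neither of them is the origin, and they lie on different coordinate axes; every other plane parallel to a coordinate plane contains at most one point of $S$. For a finite set $A$ put $\max(A,i)=\max\{x_i : x\in A\}$ and $\Pi(A)=\{x : 0\le x_i\le \max(A,i),\ i=1,2,3\}$. A point $\gamma\in S$ is a \emph{Voronoi relative minimum} of $S$ if $\Pi(\{\gamma\})$ contains no point of $S\setminus\{\gamma\}$; let $\mathrm{Vrm}(S)$ be the set of these points. A finite set $F\subset \mathrm{Vrm}(S)$ is \emph{minimal} if $\Pi(F)$ contains no point of $\mathrm{Vrm}(S)\setminus F$ and $\Pi(G)\ne\Pi(F)$ for every proper subset $G\subsetneq F$. The \emph{Minkowski--Voronoi complex} $MV(S)$ is the two-dimensional complex whose $k$-dimensional faces are the minimal $(3-k)$-element sets, the faces $F_1\ne F_2$ being adjacent when $F_1\subset F_2$. Thus its vertices are the minimal triples and its edges are the minimal pairs; an edge contained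 in two minimal triples is a finite edge joining them, and an edge contained in only one minimal triple is an infinite edge starting there. A finite edge, directed from a vertex $v$ to a vertex $w$, has \emph{label} $k\in\{0,\dots,5\}$ if, passing from $\Pi(v)$ to $\Pi(w)$, the size $\max(\cdot,i)$ increases, the size $\max(\cdot,j)$ decreases and the third size is unchanged, where $(i,j)=(2,1),(3,1),(3,2),(1,2),(1,3),(2,3)$ for $k=0,1,2,3,4,5$ respectively. A \emph{canonical diagram} of $S$ is an embedding of the $1$-skeleton of $MV(S)$ into the Euclidean plane (vertices are mapped to distinct points, an edge contains no vertices except its endpoints, and different edges meet only in common endpoints) in which finite edges are straight segments, infinite edges are rays, and (a) every finite edge has a label, and the segment from $v$ to $w$ points in the direction $k\pi/3$, where $k$ is the label of the edge directed from $v$ to $w$; (b) every vertex that is not an endpoint of an infinite edge is of one of eight types: it has exactly three finite edges, and, directed away from the vertex, one of them has direction $0$ or $\pi/3$, one has direction $2\pi/3$ or $\pi$, and one has direction $4\pi/3$ or $5\pi/3$. \textbf{Theorem.} For every finite axial set $S\subset\mathbb R^3_{\ge 0}$ in general position, $MV(S)$ admits a canonical diagram. -/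

import Mathlib

noncomputable section

namespace MinkowskiVoronoi

/-- The point `x` lies on the `i`-th coordinate axis. -/
def OnAxis {n : ℕ} (i : Fin n) (x : Fin n → ℝ) : Prop :=
  ∀ j, j ≠ i → x j = 0

/-- An axial subset of the nonnegative orthant: it has a point on every coordinate axis. -/
def IsAxial {n : ℕ} (S : Set (Fin n → ℝ)) : Prop :=
  (∀ x ∈ S, ∀ i, 0 ≤ x i) ∧ ∀ i, ∃ x ∈ S, OnAxis i x

/-- General position. Every coordinate plane `x i = 0` contains exactly `n - 1` points of `S`;
none of them is the origin, and they lie on pairwise different coordinate axes.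
Every other plane parallel to a coordinate plane contains at most one point of `S`. -/
def InGeneralPosition {n : ℕ} (S : Set (Fin n → ℝ)) : Prop :=
  (∀ i, {x ∈ S | x i = 0}.ncard = n - 1 ∧
    (∀ x ∈ S, x i = 0 → x ≠ 0 ∧ ∃ j, OnAxis j x) ∧
    (∀ x ∈ S, ∀ y ∈ S, x i = 0 → y i = 0 → x ≠ y → ∀ j, ¬ (OnAxis j x ∧ OnAxis j y))) ∧
  (∀ i, ∀ c : ℝ, c ≠ 0 → {x ∈ S | x i = c}.Subsingleton)

/-- The maximum of the `i`-th coordinate over the finite set `A` (for `A` nonempty). -/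
def maxCoord {n : ℕ} (A : Finset (Fin n → ℝ)) (i : Fin n) : ℝ :=
  sSup ((fun x : Fin n → ℝ => x i) '' (A : Set (Fin n → ℝ)))

/-- The parallelepiped `Π(A)`. -/
def box {n : ℕ} (A : Finset (Fin n → ℝ)) : Set (Fin n → ℝ) :=
  {x | ∀ i, 0 ≤ x i ∧ x i ≤ maxCoord A i}

/-- The set of Voronoi relative minima of `S`. -/
def vrm {n : ℕ} (S : Set (Fin n → ℝ)) : Set (Fin n → ℝ) :=
  {γ ∈ S | ∀ x ∈ S, x ≠ γ → x ∉ box {γ}}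

/-- `F` is a minimal subset of `vrm S`: its parallelepiped contains no further relative minimum,
and no proper subset of `F` spans the same parallelepiped. -/
def IsMinimalSubset {n : ℕ} (S : Set (Fin n → ℝ)) (F : Finset (Fin n → ℝ)) : Prop :=
  (F : Set (Fin n → ℝ)) ⊆ vrm S ∧
  (∀ x ∈ vrm S, x ∉ F → x ∉ box F) ∧
  (∀ G : Finset (Fin n → ℝ), G ⊂ F → box G ≠ box F)

/-- The set `𝔐_k(S)` of minimal `k`-element subsets. -/
def minimalSubsets {n : ℕ} (S : Set (Fin n → ℝ)) (k : ℕ) : Set (Finset (Fin n → ℝ)) :=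
  {F | IsMinimalSubset S F ∧ F.card = k}

/-- The `d`-dimensional faces of the `(n-1)`-dimensional Minkowski–Voronoi complex `MV(S)`:
the minimal `(n-d)`-element subsets. -/
abbrev MVFace {n : ℕ} (S : Set (Fin n → ℝ)) (d : Fin n) : Type :=
  {F : Finset (Fin n → ℝ) // F ∈ minimalSubsets S (n - (d : ℕ))}

/-- Adjacency of two faces of `MV(S)`: the second one lies in the closure of the first one. -/
def MVFace.Adjacent {n : ℕ} {S : Set (Fin n → ℝ)} {d e : Fin n}
    (f : MVFace S d) (g : MVFace S e) : Prop :=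
  f.1 ⊂ g.1

/-- Vertices of the three-dimensional complex: minimal triples. -/
abbrev Vertex (S : Set (Fin 3 → ℝ)) : Type := MVFace S 0

/-- Edges of the three-dimensional complex: minimal pairs. -/
abbrev Edge (S : Set (Fin 3 → ℝ)) : Type := MVFace S 1

/-- `v` and `w` are the two endpoints of the finite edge `e`. -/
def Edge.Joins {S : Set (Fin 3 → ℝ)} (e : Edge S) (v w : Vertex S) : Prop :=
  v ≠ w ∧ ∀ u : Vertex S, e.Adjacent u ↔ u = v ∨ u = w

/-- `e` is an infinite edge, and `v` is its only endpoint. -/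
def Edge.InfiniteFrom {S : Set (Fin 3 → ℝ)} (e : Edge S) (v : Vertex S) : Prop :=
  ∀ u : Vertex S, e.Adjacent u ↔ u = v

/-- The vertex `v` is an endpoint of an infinite edge. -/
def Vertex.OnInfiniteEdge {S : Set (Fin 3 → ℝ)} (v : Vertex S) : Prop :=
  ∃ e : Edge S, e.InfiniteFrom v

/-- The vertices `v` and `w` are joined by a finite edge. -/
def Vertex.Neighbor {S : Set (Fin 3 → ℝ)} (v w : Vertex S) : Prop :=
  ∃ e : Edge S, e.Joins v w

/-- The coordinate (`0, 1, 2` for `x, y, z`) that increases along an edge with label `k`. -/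
def incCoord : Fin 6 → Fin 3 := ![1, 2, 2, 0, 0, 1]

/-- The coordinate that decreases along an edge with label `k`. -/
def decCoord : Fin 6 → Fin 3 := ![0, 0, 1, 1, 2, 2]

/-- The coordinate that stays unchanged along an edge with label `k`. -/
def fixCoord : Fin 6 → Fin 3 := ![2, 1, 0, 2, 1, 0]

/-- The finite edge from `v` to `w` has label `k`: passing from `Π(v)` to `Π(w)`, the three sizes
change as prescribed by `k`. -/
def HasLabel {S : Set (Fin 3 → ℝ)} (v w : Vertex S) (k : Fin 6) : Prop :=
  v.Neighbor w ∧
  maxCoord v.1 (incCoord k) < maxCoord w.1 (incCoord k) ∧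
  maxCoord w.1 (decCoord k) < maxCoord v.1 (decCoord k) ∧
  maxCoord w.1 (fixCoord k) = maxCoord v.1 (fixCoord k)

/-- The Euclidean plane. -/
abbrev Plane : Type := EuclideanSpace ℝ (Fin 2)

/-- The unit vector in direction `k * π / 3`. -/
def direction (k : Fin 6) : Plane :=
  !₂[Real.cos ((k : ℕ) * (Real.pi / 3)), Real.sin ((k : ℕ) * (Real.pi / 3))]

/-- The closed ray from `p` with direction vector `d`. -/
def ray (p d : Plane) : Set Plane :=
  {q | ∃ t : ℝ, 0 ≤ t ∧ q = p + t • d}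

/-- With the vertices placed at `pos`, the finite edge from `v` to `w` has label `k` and
points in the direction of this label. -/
def DrawnWithLabel {S : Set (Fin 3 → ℝ)} (pos : Vertex S → Plane) (v w : Vertex S)
    (k : Fin 6) : Prop :=
  HasLabel v w k ∧ ∃ t : ℝ, 0 < t ∧ pos w - pos v = t • direction k

/-- The star of `v` is of one of the eight types: there are exactly three finite edges at `v`,
one of them in direction `0` or `π/3`, one in direction `2π/3` or `π`, and one in direction
`4π/3` or `5π/3`. -/
def HasAllowedType {S : Set (Fin 3 → ℝ)} (pos : Vertex S → Plane) (v : Vertex S) : Prop :=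
  ∃ (w : Fin 3 → Vertex S) (k : Fin 3 → Fin 6),
    Function.Injective w ∧
    (∀ u : Vertex S, v.Neighbor u ↔ ∃ j, u = w j) ∧
    (k 0 = 0 ∨ k 0 = 1) ∧ (k 1 = 2 ∨ k 1 = 3) ∧ (k 2 = 4 ∨ k 2 = 5) ∧
    ∀ j, DrawnWithLabel pos v (w j) (k j)

/-- A canonical diagram of `S`: vertices are drawn at the points `pos v`, edges as the
sets `carrier e`. -/
structure IsCanonicalDiagram (S : Set (Fin 3 → ℝ)) (pos : Vertex S → Plane)
    (carrier : Edge S → Set Plane) : Prop where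
  /-- Finite edges are drawn as segments between their endpoints, infinite edges as rays. -/
  linear : ∀ e : Edge S,
    (∃ v w : Vertex S, e.Joins v w ∧ carrier e = segment ℝ (pos v) (pos w)) ∨
    (∃ (v : Vertex S) (d : Plane), e.InfiniteFrom v ∧ d ≠ 0 ∧ carrier e = ray (pos v) d)
  /-- Different vertices are drawn at different points. -/
  pos_injective : Function.Injective pos
  /-- An edge passes through no vertices except its endpoints. -/
  vertex_of_mem : ∀ (v : Vertex S) (e : Edge S), pos v ∈ carrier e → e.Adjacent v
  /-- Different edges meet only in common endpoints. -/
  inter_carrier : ∀ e f : Edge S, e ≠ f → ∀ p ∈ carrier e ∩ carrier f,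
    ∃ v : Vertex S, e.Adjacent v ∧ f.Adjacent v ∧ p = pos v
  /-- All finite edges point in the directions of their labels. -/
  labels : ∀ v w : Vertex S, v.Neighbor w → ∃ k : Fin 6, DrawnWithLabel pos v w k
  /-- Vertices that are not on infinite edges are of one of the eight types. -/
  types : ∀ v : Vertex S, ¬ v.OnInfiniteEdge → HasAllowedType pos v

/-- The complex `MV(S)` admits a canonical diagram. -/
def AdmitsCanonicalDiagram (S : Set (Fin 3 → ℝ)) : Prop :=
  ∃ (pos : Vertex S → Plane) (carrier : Edge S → Set Plane), IsCanonicalDiagram S pos carrier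

end MinkowskiVoronoi

end

/-!
# Canonical diagrams of Minkowski-Voronoi complexes

The relative minima of `S` form a finite antichain in which, after breaking ties at `0`, no two
points share a coordinate (`exists_genericAntichain`). Only the order of the coordinates matters for
the complex: a minimal triple is a triple `t` whose point `t i` has the largest `i`-th coordinate,
with an otherwise empty box, and along an edge of the complex one size decreases, one increases and
one is unchanged.

*Directions.* Suppose that the coordinates can be replaced by new heights `f p i` such that the
corners `(f (t 0) 0, f (t 1) 1, f (t 2) 2)` of all minimal triples lie on the plane
`x + y + z = 0`, and the order of coordinates along every minimal pair is kept. Then along an edge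
of the complex the increase of one size equals the decrease of another one, so a parallel
projection of this plane draws every edge in the direction of its label. Dropping the point with
label `m` from a triple decreases the `m`-th size, which gives the eight types of vertices.

*Heights* (`GenericAntichain.exists_coplanar`). Sweep space by horizontal planes from above. The
Pareto minima of the points below the plane, projected to the first two coordinates, form a
staircase. When the sweep passes `p`, this point is replaced on the staircase by the points that
it removes in the sweep from below, and the corners between these are exactly the triples with
highest point `p`. Placing the new points at equal small distances keeps the staircase monotone
(`IsStair.add_gap_le`) and puts the new corners at one height, which is taken as the new third
coordinate of `p`. Distances that decrease geometrically from level to level make this work.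

*Embedding.* Assign to each point `p` its face `Hex p`, a convex hexagon bounded by the heights of
`p` from below and by those of its neighbours from above. A corner lies on the faces of the three
points of its triple and on no others (`IsMono.hex_corner`, `IsMono.exists_eq_of_hex_corner`); an
interior point of an edge lies on the faces of the two points of the edge and on no others
(`IsFlip.eq_or_eq_of_hex`, `IsTriple.eq_or_eq_of_hex_ray`). Hence vertices are distinct, and edges
meet only in common endpoints. The comparisons of heights behind these facts come from the order
along minimal pairs: if no point in the box of `p` and `w` is lower than `p` in coordinate `i`, then
a chain of minimal pairs inside this box leads from `w` down to `p` (`IsMono.lt_of_box`).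
-/

/-! ### Generic antichains, minimal pairs and minimal triples -/

namespace MinkowskiVoronoi

/-- A finite set `V` of pairwise incomparable points of space, given by their coordinates
`g p i`, in strict general position: no two points share a coordinate. The three points `a i`
play the role of the points on the coordinate axes: `a i` is the highest point in coordinate `i`,
and the other two are lower in coordinate `i` than all remaining points. Ties between the axis
points are broken by their index. -/
structure GenericAntichain (V : Type*) where
  /-- The coordinates. -/
  g : V → Fin 3 → ℝ
  inj : ∀ i p q, g p i = g q i → p = q
  anti : ∀ p q, (∀ i, g p i ≤ g q i) → p = q
  /-- The axis points. -/
  a : Fin 3 → V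
  top : ∀ i p, g p i ≤ g (a i) i
  low : ∀ p, (∀ m, p ≠ a m) → ∀ i j, i ≠ j → g (a i) j < g p j
  low_axis : ∀ i j k, i ≠ j → k ≠ j → i < k → g (a i) j < g (a k) j

namespace GenericAntichain

variable {V : Type*} (A : GenericAntichain V)

/-- `p` is an axis point whose `i`-th coordinate stands for `0`. -/
def Null (p : V) (i : Fin 3) : Prop := ∃ j, j ≠ i ∧ p = A.a j

/-- `t i` is the point attaining the `i`-th size of a minimal triple. -/
structure IsTriple (t : Fin 3 → V) : Prop where
  lt : ∀ i j, j ≠ i → A.g (t j) i < A.g (t i) i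
  mem : ∀ q, (∀ i, A.g q i ≤ A.g (t i) i) → ∃ j, q = t j

/-- `p` and `q` form a minimal pair. -/
structure IsEdge (p q : V) : Prop where
  ne : p ≠ q
  mem : ∀ u, (∀ i, A.g u i ≤ max (A.g p i) (A.g q i)) → u = p ∨ u = q

theorem fin_three_cases {i j k : Fin 3} (hij : i ≠ j) (hik : i ≠ k) (hjk : j ≠ k) (m : Fin 3) :
    m = i ∨ m = j ∨ m = k := by
  omega

theorem exists_third (i j : Fin 3) : ∃ k, i ≠ k ∧ j ≠ k := by
  revert i j; decide

theorem exists_two_ne (i : Fin 3) : ∃ j k : Fin 3, j ≠ k ∧ j ≠ i ∧ k ≠ i := by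
  revert i; decide

theorem lt_or_lt {p q : V} (h : p ≠ q) (i : Fin 3) : A.g p i < A.g q i ∨ A.g q i < A.g p i :=
  lt_or_gt_of_ne fun e => h (A.inj i p q e)

theorem lt_of_le {p q : V} (h : p ≠ q) {i : Fin 3} (hle : A.g p i ≤ A.g q i) :
    A.g p i < A.g q i :=
  lt_of_le_of_ne hle fun e => h (A.inj i p q e)

theorem ne_of_lt {p q : V} {i : Fin 3} (h : A.g p i < A.g q i) : p ≠ q := by
  rintro rfl; exact lt_irrefl _ h

/-- Incomparability, with the coordinates named: a point that is lower in two coordinates is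
higher in the third. -/
theorem lt_third {i j k : Fin 3} (hij : i ≠ j) (hik : i ≠ k) (hjk : j ≠ k) {p q : V}
    (hi : A.g p i < A.g q i) (hj : A.g p j < A.g q j) : A.g q k < A.g p k := by
  by_contra! h
  refine A.ne_of_lt hi (A.anti p q fun m => ?_)
  rcases fin_three_cases hij hik hjk m with rfl | rfl | rfl
  exacts [hi.le, hj.le, h]

theorem a_ne {i j : Fin 3} (h : i ≠ j) : A.a i ≠ A.a j := by
  obtain ⟨k, hik, hjk⟩ := exists_third i j
  rcases lt_or_gt_of_ne h with hlt | hlt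
  · exact A.ne_of_lt (A.low_axis i k j hik hjk hlt)
  · exact (A.ne_of_lt (A.low_axis j k i hjk hik hlt)).symm

theorem lt_top {p : V} {i : Fin 3} (h : p ≠ A.a i) : A.g p i < A.g (A.a i) i :=
  A.lt_of_le h (A.top i p)

theorem low_of_not_null {p : V} {i j : Fin 3} (hij : i ≠ j) (h : ¬ A.Null p j) :
    A.g (A.a i) j < A.g p j := by
  by_cases hp : p = A.a j
  · subst hp; exact A.lt_top (A.a_ne hij)
  · refine A.low p (fun m hm => ?_) i j hij
    by_cases hmj : m = j
    · exact hp (hmj ▸ hm)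
    · exact h ⟨m, hmj, hm⟩

theorem not_null_of_lt {p q : V} {i : Fin 3} (h : ¬ A.Null p i) (hpq : A.g p i ≤ A.g q i) :
    ¬ A.Null q i := by
  rintro ⟨j, hj, rfl⟩
  exact absurd (A.low_of_not_null hj h) (not_lt.2 hpq)

/-- A coordinate of a point that exceeds those of two other points is not a null coordinate. -/
theorem not_null_of_lt_of_lt {p q r : V} {i : Fin 3} (hpq : p ≠ q) (hp : A.g p i < A.g r i)
    (hq : A.g q i < A.g r i) : ¬ A.Null r i := by
  intro hr
  have hnull : ∀ {s : V}, A.g s i < A.g r i → A.Null s i := fun {s} hs => by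
    by_contra h
    exact A.not_null_of_lt h hs.le hr
  obtain ⟨j, hj, rfl⟩ := hr
  obtain ⟨k, hk, rfl⟩ := hnull hp
  obtain ⟨l, hl, rfl⟩ := hnull hq
  have hkj : k ≠ j := by rintro rfl; exact lt_irrefl _ hp
  have hlj : l ≠ j := by rintro rfl; exact lt_irrefl _ hq
  have hkl : k ≠ l := by rintro rfl; exact hpq rfl
  omega

variable {A}

theorem IsTriple.not_null {t : Fin 3 → V} (ht : A.IsTriple t) (i : Fin 3) : ¬ A.Null (t i) i := by
  obtain ⟨j, k, hjk, hji, hki⟩ := exists_two_ne i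
  refine A.not_null_of_lt_of_lt (A.ne_of_lt (ht.lt k j hjk)) (ht.lt i j hji) (ht.lt i k hki)

theorem IsTriple.injective {t : Fin 3 → V} (ht : A.IsTriple t) : Function.Injective t := by
  intro i j h
  by_contra hij
  exact A.ne_of_lt (ht.lt j i hij) h

theorem IsTriple.le {t : Fin 3 → V} (ht : A.IsTriple t) (i j : Fin 3) :
    A.g (t j) i ≤ A.g (t i) i := by
  by_cases h : j = i
  · rw [h]
  · exact (ht.lt i j h).le

theorem IsEdge.symm {p q : V} (h : A.IsEdge p q) : A.IsEdge q p :=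
  ⟨h.ne.symm, fun u hu => (h.mem u fun i => by rw [max_comm]; exact hu i).symm⟩

theorem IsTriple.isEdge {t : Fin 3 → V} (ht : A.IsTriple t) {i j : Fin 3} (hij : i ≠ j) :
    A.IsEdge (t i) (t j) := by
  refine ⟨fun h => hij (ht.injective h), fun u hu => ?_⟩
  obtain ⟨k, hik, hjk⟩ := exists_third i j
  obtain ⟨m, rfl⟩ := ht.mem u fun m => (hu m).trans (max_le (ht.le m i) (ht.le m j))
  rcases fin_three_cases hij hik hjk m with rfl | rfl | rfl
  · exact Or.inl rfl
  · exact Or.inr rfl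
  · exact absurd (hu m) (not_le.2 (max_lt (ht.lt m i hik) (ht.lt m j hjk)))

/-- A triple is determined by two of its labelled points. -/
theorem IsTriple.eq_of_eq {t t' : Fin 3 → V} (ht : A.IsTriple t) (ht' : A.IsTriple t')
    {i j k : Fin 3} (hij : i ≠ j) (hik : i ≠ k) (hjk : j ≠ k) (hj : t j = t' j) (hk : t k = t' k) :
    t = t' := by
  have main : ∀ {t t' : Fin 3 → V}, A.IsTriple t → A.IsTriple t' → t j = t' j → t k = t' k →
      A.g (t i) i ≤ A.g (t' i) i → t i = t' i := by
    intro t t' ht ht' hj hk hle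
    obtain ⟨m, hm⟩ := ht'.mem (t i) fun m => by
      rcases fin_three_cases hij hik hjk m with rfl | rfl | rfl
      · exact hle
      · rw [← hj]; exact ht.le _ _
      · rw [← hk]; exact ht.le _ _
    rcases fin_three_cases hij hik hjk m with rfl | rfl | rfl
    · exact hm
    · exact absurd (ht.injective (hm.trans hj.symm)) hij
    · exact absurd (ht.injective (hm.trans hk.symm)) hik
  have hi : t i = t' i := by
    rcases le_total (A.g (t i) i) (A.g (t' i) i) with h | h
    · exact main ht ht' hj hk h
    · exact (main ht' ht hj.symm hk.symm h).symm
  funext m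
  rcases fin_three_cases hij hik hjk m with rfl | rfl | rfl <;> assumption

/-- Of two incomparable points, one (`p`) is higher in exactly two coordinates. -/
theorem IsEdge.exists_orientation {p q : V} (h : A.IsEdge p q) :
    ∃ i j k : Fin 3, i ≠ j ∧ i ≠ k ∧ j ≠ k ∧
      ((A.g q i < A.g p i ∧ A.g q j < A.g p j ∧ A.g p k < A.g q k) ∨
       (A.g p i < A.g q i ∧ A.g p j < A.g q j ∧ A.g q k < A.g p k)) := by
  have h0 := A.lt_or_lt h.ne 0
  have h1 := A.lt_or_lt h.ne 1
  have h2 := A.lt_or_lt h.ne 2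
  rcases h0 with h0 | h0 <;> rcases h1 with h1 | h1
  · exact ⟨0, 1, 2, by decide, by decide, by decide, Or.inr
      ⟨h0, h1, A.lt_third (by decide) (by decide) (by decide) h0 h1⟩⟩
  · rcases h2 with h2 | h2
    · exact ⟨0, 2, 1, by decide, by decide, by decide, Or.inr ⟨h0, h2, h1⟩⟩
    · exact ⟨1, 2, 0, by decide, by decide, by decide, Or.inl ⟨h1, h2, h0⟩⟩
  · rcases h2 with h2 | h2
    · exact ⟨1, 2, 0, by decide, by decide, by decide, Or.inr ⟨h1, h2, h0⟩⟩
    · exact ⟨0, 2, 1, by decide, by decide, by decide, Or.inl ⟨h0, h2, h1⟩⟩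
  · exact ⟨0, 1, 2, by decide, by decide, by decide, Or.inl
      ⟨h0, h1, A.lt_third (by decide) (by decide) (by decide) h0 h1⟩⟩

section Finite

variable [Finite V]

/-- A minimal pair `p, q`, with `p` higher in the coordinates `i, j` and `q` in `k`, extends to a
triple by the lowest point in direction `i` among those below `p` in `j` and below `q` in `k`. -/
theorem IsEdge.exists_triple {p q : V} (h : A.IsEdge p q) {i j k : Fin 3} (hij : i ≠ j)
    (hik : i ≠ k) (hjk : j ≠ k) (hi : A.g q i < A.g p i) (hj : A.g q j < A.g p j)
    (hk : A.g p k < A.g q k) (hex : ∃ u, A.g u j < A.g p j ∧ A.g u k < A.g q k) :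
    ∃ t, A.IsTriple t ∧ t j = p ∧ t k = q := by
  classical
  obtain ⟨r, ⟨hrj, hrk⟩, hr⟩ := (Set.toFinite {u | A.g u j < A.g p j ∧ A.g u k < A.g q k})
    |>.exists_minimalFor (fun u => A.g u i) _ hex
  have hri : A.g p i < A.g r i := by
    by_contra! hle
    rcases h.mem r fun m => by
      rcases fin_three_cases hij hik hjk m with rfl | rfl | rfl
      · exact hle.trans (le_max_left _ _)
      · exact hrj.le.trans (le_max_left _ _)
      · exact hrk.le.trans (le_max_right _ _) with rfl | rfl
    · exact lt_irrefl _ hrj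
    · exact lt_irrefl _ hrk
  have ei : (fun m => if m = i then r else if m = j then p else q) i = r := by simp
  have ej : (fun m => if m = i then r else if m = j then p else q) j = p := by simp [hij.symm]
  have ek : (fun m => if m = i then r else if m = j then p else q) k = q := by
    simp [hik.symm, hjk.symm]
  refine ⟨fun m => if m = i then r else if m = j then p else q, ?_, ej, ek⟩
  generalize (fun m => if m = i then r else if m = j then p else q) = t at ei ej ek
  refine ⟨fun m n hmn => ?_, fun u hu => ?_⟩
  · rcases fin_three_cases hij hik hjk m with rfl | rfl | rfl <;>
      rcases fin_three_cases hij hik hjk n with rfl | rfl | rfl <;>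
      first | exact absurd rfl hmn | (simp only [ei, ej, ek]; first | assumption | exact hi.trans hri)
  · by_cases hp : u = p
    · exact ⟨j, hp.trans ej.symm⟩
    by_cases hq : u = q
    · exact ⟨k, hq.trans ek.symm⟩
    have huj := hu j
    have huk := hu k
    have hui := hu i
    rw [ei] at hui
    rw [ej] at huj
    rw [ek] at huk
    refine ⟨i, (A.inj i u r (le_antisymm hui ?_)).trans ei.symm⟩
    exact hr ⟨A.lt_of_le hp huj, A.lt_of_le hq huk⟩ hui

/-- Inside the box of any two points `w, r` there is a point joined to `w` by an edge. -/
theorem exists_isEdge {w r : V} (h : r ≠ w) :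
    ∃ q, A.IsEdge w q ∧ ∀ i, A.g q i ≤ max (A.g r i) (A.g w i) := by
  induction hn : Set.ncard {u | ∀ i, A.g u i ≤ max (A.g r i) (A.g w i)} using
    Nat.strong_induction_on generalizing r with
  | _ n ih =>
    by_cases hE : A.IsEdge w r
    · exact ⟨r, hE, fun i => le_max_left _ _⟩
    · have hx : ∃ u, (∀ i, A.g u i ≤ max (A.g r i) (A.g w i)) ∧ u ≠ w ∧ u ≠ r := by
        by_contra! hno
        refine hE ⟨h.symm, fun u hu => ?_⟩
        by_contra! hc
        exact hc.2 (hno u (fun i => by rw [max_comm]; exact hu i) hc.1)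
      obtain ⟨u, hu, huw, hur⟩ := hx
      have hsub : {x | ∀ i, A.g x i ≤ max (A.g u i) (A.g w i)} ⊆
          {x | ∀ i, A.g x i ≤ max (A.g r i) (A.g w i)} := fun x hx i =>
        (hx i).trans (max_le (hu i) (le_max_right _ _))
      -- `r` itself drops out of the smaller box
      have hrn : r ∉ {x | ∀ i, A.g x i ≤ max (A.g u i) (A.g w i)} := by
        intro hr
        have hle : ∀ i, A.g r i ≤ A.g w i := by
          intro i
          by_contra! hlt
          have h1 := hu i
          rw [max_eq_left hlt.le] at h1
          have h2 := A.lt_of_le hur h1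
          exact absurd (hr i) (not_le.2 (max_lt h2 hlt))
        exact h (A.anti r w hle)
      have hlt := Set.ncard_lt_ncard
        ⟨hsub, fun hsup => hrn (hsup fun i => le_max_left _ _)⟩ (Set.toFinite _)
      obtain ⟨q, hq, hqb⟩ := ih _ (hn ▸ hlt) huw rfl
      exact ⟨q, hq, hsub hqb⟩

end Finite

end GenericAntichain

end MinkowskiVoronoi

/-! ### The outgoing edges of a point and the sweep -/

namespace MinkowskiVoronoi

namespace GenericAntichain

variable {V : Type*} (A : GenericAntichain V)

/-- `p` is one of the three axis points. -/
def IsAxisPoint (p : V) : Prop := ∃ m, p = A.a m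

variable {A}

theorem exists_below {p : V} (hp : ¬ A.IsAxisPoint p) (i : Fin 3) :
    ∃ q, ∀ j, j ≠ i → A.g q j < A.g p j :=
  ⟨A.a i, fun j hj => A.low p (fun m hm => hp ⟨m, hm⟩) i j hj.symm⟩

/-- The points other than `A.a 0` and `A.a 1` have outgoing edges in directions `0` and `1`. -/
theorem exists_below' {p : V} (h0 : p ≠ A.a 0) (h1 : p ≠ A.a 1) {i : Fin 3} (hi : i ≠ 2) :
    ∃ q, ∀ j, j ≠ i → A.g q j < A.g p j := by
  by_cases hp : A.IsAxisPoint p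
  · obtain ⟨m, rfl⟩ := hp
    have hm : m = 2 := by
      have : m ≠ 0 := by rintro rfl; exact h0 rfl
      have : m ≠ 1 := by rintro rfl; exact h1 rfl
      omega
    subst hm
    refine ⟨A.a i, fun j hj => ?_⟩
    by_cases hj2 : j = 2
    · subst hj2; exact A.lt_top (A.a_ne hi)
    · exact A.low_axis i j 2 hj.symm (Ne.symm hj2) (by omega)
  · exact exists_below hp i

variable (A)

section Finite

variable [Finite V]

open Classical in
/-- The lowest point in direction `i` among the points below `p` in the other two coordinates;
the value is `A.a i` if there are no such points. -/
noncomputable def out (i : Fin 3) (p : V) : V :=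
  if h : ∃ q, ∀ j, j ≠ i → A.g q j < A.g p j then
    ((Set.toFinite {q | ∀ j, j ≠ i → A.g q j < A.g p j}).exists_minimalFor
      (fun q => A.g q i) _ h).choose
  else A.a i

variable {A}

theorem out_lt {i : Fin 3} {p : V} (h : ∃ q, ∀ j, j ≠ i → A.g q j < A.g p j) :
    ∀ j, j ≠ i → A.g (A.out i p) j < A.g p j := by
  rw [out, dif_pos h]
  exact ((Set.toFinite {q | ∀ j, j ≠ i → A.g q j < A.g p j}).exists_minimalFor
      (fun q => A.g q i) _ h).choose_spec.1

theorem out_le {i : Fin 3} {p q : V} (h : ∀ j, j ≠ i → A.g q j < A.g p j) :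
    A.g (A.out i p) i ≤ A.g q i := by
  have h' : ∃ q, ∀ j, j ≠ i → A.g q j < A.g p j := ⟨q, h⟩
  rw [out, dif_pos h']
  have hm := ((Set.toFinite {q | ∀ j, j ≠ i → A.g q j < A.g p j}).exists_minimalFor
      (fun q => A.g q i) _ h').choose_spec
  rcases le_total (A.g (((Set.toFinite {q | ∀ j, j ≠ i → A.g q j < A.g p j}).exists_minimalFor
      (fun q => A.g q i) _ h').choose) i) (A.g q i) with h1 | h1
  · exact h1
  · exact hm.2 h h1

/-- A minimal pair in which `p` is higher in two coordinates is an outgoing edge of `p`. -/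
theorem IsEdge.eq_out {p q : V} (h : A.IsEdge p q) {i : Fin 3}
    (hq : ∀ j, j ≠ i → A.g q j < A.g p j) : q = A.out i p := by
  have h1 := out_lt ⟨q, hq⟩
  have h2 := out_le hq
  obtain ⟨j, -, -, hj, -⟩ := exists_two_ne i
  rcases h.mem (A.out i p) fun m => by
    by_cases hm : m = i
    · subst hm; exact h2.trans (le_max_right _ _)
    · exact (h1 m hm).le.trans (le_max_left _ _) with e | e
  · exact absurd e (A.ne_of_lt (h1 j hj))
  · exact e.symm

variable (A)

/-- The number of points above `p` in the last coordinate. Sweeping space by planes from above,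
`p` is met at time `A.depth p`. -/
noncomputable def depth (p : V) : ℕ := {q | A.g p 2 < A.g q 2}.ncard

open Classical in
/-- In the sweep from above, the point `p` appears on the staircase of the Pareto minima of the
points below the plane as soon as the plane has passed `A.out 2 p`, and it leaves the staircase at
its own height. Hence the staircase at time `n` consists of the points with
`A.birth p ≤ n ≤ A.depth p`. -/
noncomputable def birth (p : V) : ℕ := if A.IsAxisPoint p then 0 else A.depth (A.out 2 p) + 1

variable {A}

theorem depth_lt_depth {p q : V} (h : A.g p 2 < A.g q 2) : A.depth q < A.depth p := by
  refine Set.ncard_lt_ncard ⟨fun x hx => lt_trans h hx, fun hsup => ?_⟩ (Set.toFinite _)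
  exact lt_irrefl (A.g q 2) (hsup (show q ∈ {x | A.g p 2 < A.g x 2} from h))

theorem lt_of_depth_lt {p q : V} (h : A.depth q < A.depth p) : A.g p 2 < A.g q 2 := by
  by_contra! hle
  by_cases e : p = q
  · subst e; exact lt_irrefl _ h
  · exact lt_asymm h (depth_lt_depth (A.lt_of_le (Ne.symm e) hle))

theorem depth_injective {p q : V} (h : A.depth p = A.depth q) : p = q := by
  by_contra e
  rcases A.lt_or_lt e 2 with h' | h'
  · exact (depth_lt_depth h').ne' h
  · exact (depth_lt_depth h').ne h

theorem birth_axis {p : V} (h : A.IsAxisPoint p) : A.birth p = 0 := if_pos h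

theorem birth_of_not_axis {p : V} (h : ¬ A.IsAxisPoint p) :
    A.birth p = A.depth (A.out 2 p) + 1 := if_neg h

theorem out_two_lt {u : V} (hu : ¬ A.IsAxisPoint u) {i : Fin 3} (hi : i ≠ 2) :
    A.g (A.out 2 u) i < A.g u i :=
  out_lt (exists_below hu 2) i hi

theorem lt_out_two {u : V} (hu : ¬ A.IsAxisPoint u) : A.g u 2 < A.g (A.out 2 u) 2 :=
  A.lt_third (i := 0) (j := 1) (by decide) (by decide) (by decide)
    (out_two_lt hu (by decide)) (out_two_lt hu (by decide))

theorem birth_le_depth (p : V) : A.birth p ≤ A.depth p := by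
  by_cases h : A.IsAxisPoint p
  · rw [birth_axis h]; exact Nat.zero_le _
  · rw [birth_of_not_axis h]; exact depth_lt_depth (lt_out_two h)

/-- In the sweep from below, `u` is removed at the level of any point `q` lower in the first two
coordinates, if not before. Axis points are never removed. -/
theorem depth_lt_birth {q u : V} {i j : Fin 3} (hi : i ≠ 2) (hj : j ≠ 2) (hij : i ≠ j)
    (hqi : A.g q i < A.g u i) (hqj : A.g q j < A.g u j) :
    ¬ A.IsAxisPoint u ∧ A.depth q < A.birth u := by
  have h : ∀ m, m ≠ 2 → A.g q m < A.g u m := fun m hm => by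
    rcases fin_three_cases hij hi hj m with rfl | rfl | rfl
    exacts [hqi, hqj, absurd rfl hm]
  have hu : ¬ A.IsAxisPoint u := by
    rintro ⟨m, rfl⟩
    have h2 : A.g (A.a m) 2 < A.g q 2 := A.lt_third hij hi hj hqi hqj
    have hm2 : m ≠ 2 := by rintro rfl; exact absurd h2 (not_lt.2 (A.top 2 q))
    obtain ⟨n, hmn, hn2⟩ := exists_third m 2
    have hqn := h n hn2.symm
    have hnull : A.Null q n := by
      by_contra hc
      exact lt_asymm hqn (A.low_of_not_null hmn hc)
    obtain ⟨l, hln, rfl⟩ := hnull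
    by_cases hl2 : l = 2
    · subst hl2
      exact lt_asymm hqn (A.low_axis m n 2 hmn hn2 (by omega))
    · obtain rfl : l = m := by omega
      exact lt_irrefl _ hqn
  refine ⟨hu, ?_⟩
  rw [birth_of_not_axis hu]
  have hle := out_le h
  by_cases e : q = A.out 2 u
  · rw [e]; exact Nat.lt_succ_self _
  · exact (depth_lt_depth (A.lt_of_le (Ne.symm e) hle)).trans (Nat.lt_succ_self _)

/-- The neighbour `A.out i p` on the staircase, `i ≠ 2`, is present when `p` appears. -/
theorem birth_out_le {p : V} {i : Fin 3} (hi : i ≠ 2)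
    (hex : ∃ q, ∀ j, j ≠ i → A.g q j < A.g p j) : A.birth (A.out i p) ≤ A.depth p := by
  by_cases hr : A.IsAxisPoint (A.out i p)
  · rw [birth_axis hr]; exact Nat.zero_le _
  rw [birth_of_not_axis hr]
  by_contra! hlt
  obtain ⟨j, hij, hj2'⟩ := exists_third i 2
  have hj2 := hj2'.symm
  have h1 := out_lt hex
  have hqi := out_two_lt hr hi
  have hqj := (out_two_lt hr hj2).trans (h1 j hij.symm)
  have hne : A.out 2 (A.out i p) ≠ p := A.ne_of_lt hqj
  have hle : A.depth p ≤ A.depth (A.out 2 (A.out i p)) := by omega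
  have hq2 : A.g (A.out 2 (A.out i p)) 2 < A.g p 2 := by
    refine lt_of_depth_lt (lt_of_le_of_ne hle fun e => hne (depth_injective e).symm)
  refine absurd (out_le (i := i) (p := p) (q := A.out 2 (A.out i p)) fun m hm => ?_) (not_le.2 hqi)
  rcases fin_three_cases hij hi hj2 m with rfl | rfl | rfl
  exacts [absurd rfl hm, hqj, hq2]

theorem lt_out {p : V} {i : Fin 3} (hex : ∃ q, ∀ j, j ≠ i → A.g q j < A.g p j) :
    A.g p i < A.g (A.out i p) i := by
  obtain ⟨j, k, hjk, hj, hk⟩ := exists_two_ne i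
  exact A.lt_third hjk hj hk (out_lt hex j hj) (out_lt hex k hk)

end Finite

end GenericAntichain

end MinkowskiVoronoi

/-! ### Coplanar heights -/

namespace MinkowskiVoronoi

namespace GenericAntichain

variable {V : Type*} (A : GenericAntichain V) [Finite V]

/-- The points removed by `p` in the sweep from below: those for which `p` is the first point on
the way up that is lower in the first two coordinates. In the sweep from above they take the place
of `p` on the staircase. -/
def children (p : V) : Set V := {c | ¬ A.IsAxisPoint c ∧ A.out 2 c = p}

/-- The distance of consecutive new points placed when the sweep passes `p`. -/
noncomputable def step (p : V) : ℝ := (1 / (Nat.card V : ℝ)) ^ A.depth p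

/-- A lower bound for the distance of `p`, in each of the first two directions, to the points that
are higher in this direction and are on a staircase together with `p`. -/
noncomputable def gap (p : V) : ℝ := (Nat.card V : ℝ) * (1 / (Nat.card V : ℝ)) ^ A.birth p

/-- The recursion for the heights in direction `i` (one of the first two directions): when the
sweep from above passes `p`, the points removed by `p` are put next to `A.out i p`, at distances
`A.step p`. -/
structure IsStair (i : Fin 3) (F : V → ℝ) : Prop where
  base : F (A.a i) = 0
  base_two : F (A.a 2) = -(Nat.card V : ℝ)
  base_of_ne : ∀ j, j ≠ i → j ≠ 2 → F (A.a j) = -(2 * (Nat.card V : ℝ))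
  rec_eq : ∀ u, ¬ A.IsAxisPoint u → F u = F (A.out i (A.out 2 u)) -
    A.step (A.out 2 u) * ({c ∈ A.children (A.out 2 u) | A.g u i ≤ A.g c i}.ncard : ℝ)

variable {A}

theorem card_pos (A : GenericAntichain V) : (0 : ℝ) < Nat.card V := by
  have : Nonempty V := ⟨A.a 0⟩
  exact_mod_cast Nat.card_pos

theorem step_pos (p : V) : 0 < A.step p :=
  pow_pos (one_div_pos.2 (card_pos A)) _

theorem gap_pos (p : V) : 0 < A.gap p :=
  mul_pos (card_pos A) (pow_pos (one_div_pos.2 (card_pos A)) _)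

theorem gap_eq_step {u : V} (hu : ¬ A.IsAxisPoint u) : A.gap u = A.step (A.out 2 u) := by
  have := (card_pos A).ne'
  rw [gap, step, birth_of_not_axis hu, pow_succ]
  field_simp

theorem card_mul_step_le_gap (p : V) : (Nat.card V : ℝ) * A.step p ≤ A.gap p := by
  have h1 : (1 : ℝ) ≤ Nat.card V := by
    have : Nonempty V := ⟨A.a 0⟩
    exact_mod_cast Nat.card_pos
  refine mul_le_mul_of_nonneg_left ?_ (card_pos A).le
  exact pow_le_pow_of_le_one (one_div_nonneg.2 (card_pos A).le)
    ((div_le_one (card_pos A)).2 h1) (birth_le_depth p)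

theorem step_mul_ncard_lt_gap (p : V) : A.step p * ((A.children p).ncard : ℝ) < A.gap p := by
  refine lt_of_lt_of_le ?_ (card_mul_step_le_gap p)
  rw [mul_comm]
  refine mul_lt_mul_of_pos_right ?_ (step_pos p)
  have hp : p ∉ A.children p := fun h => by
    have := lt_out_two h.1
    rw [h.2] at this
    exact lt_irrefl _ this
  rw [← Set.ncard_univ]
  exact_mod_cast Set.ncard_lt_ncard ⟨Set.subset_univ _, fun h => hp (h trivial)⟩ (Set.toFinite _)

theorem step_mul_ncard_sep_le (p : V) (P : V → Prop) :
    A.step p * ({c ∈ A.children p | P c}.ncard : ℝ) ≤ A.step p * ((A.children p).ncard : ℝ) := by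
  refine mul_le_mul_of_nonneg_left ?_ (step_pos p).le
  exact_mod_cast Set.ncard_le_ncard (Set.sep_subset _ _) (Set.toFinite _)

theorem exists_rec {α : Type*} (μ : α → ℕ) (B : α → Prop) (s : α → α) (b c : α → ℝ)
    (h : ∀ u, ¬ B u → μ (s u) < μ u) :
    ∃ f : α → ℝ, (∀ u, B u → f u = b u) ∧ ∀ u, ¬ B u → f u = f (s u) + c u := by
  classical
  let f : α → ℝ := WellFounded.fix (measure μ).wf fun u rec =>
    if hu : B u then b u else rec (s u) (h u hu) + c u
  have hf : ∀ u, f u = if B u then b u else f (s u) + c u := fun u => by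
    show WellFounded.fix _ _ _ = _
    rw [WellFounded.fix_eq]
    split <;> rfl
  exact ⟨f, fun u hu => by rw [hf, if_pos hu], fun u hu => by rw [hf, if_neg hu]⟩

theorem out_two_ne {u : V} (hu : ¬ A.IsAxisPoint u) {i : Fin 3} (hi : i ≠ 2) :
    A.out 2 u ≠ A.a i := fun h =>
  absurd (out_two_lt hu hi) (not_lt.2 (h ▸ A.top i u))

theorem exists_below_out_two {u : V} (hu : ¬ A.IsAxisPoint u) {i : Fin 3} (hi : i ≠ 2) :
    ∃ q, ∀ j, j ≠ i → A.g q j < A.g (A.out 2 u) j :=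
  exists_below' (out_two_ne hu (by decide)) (out_two_ne hu (by decide)) hi

variable (A) in
theorem exists_isStair {i : Fin 3} (hi : i ≠ 2) : ∃ F, A.IsStair i F := by
  classical
  obtain ⟨F, h1, h2⟩ := exists_rec A.birth A.IsAxisPoint (fun u => A.out i (A.out 2 u))
    (fun u => if u = A.a i then 0 else if u = A.a 2 then -(Nat.card V : ℝ)
      else -(2 * (Nat.card V : ℝ)))
    (fun u => -(A.step (A.out 2 u) *
      ({c ∈ A.children (A.out 2 u) | A.g u i ≤ A.g c i}.ncard : ℝ)))
    (fun u hu => by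
      rw [birth_of_not_axis hu]
      exact Nat.lt_succ_of_le (birth_out_le hi (exists_below_out_two hu hi)))
  refine ⟨F, ?_, ?_, fun j hj hj2 => ?_, fun u hu => ?_⟩
  · rw [h1 _ ⟨i, rfl⟩, if_pos rfl]
  · rw [h1 _ ⟨2, rfl⟩, if_neg (A.a_ne hi.symm), if_pos rfl]
  · rw [h1 _ ⟨j, rfl⟩, if_neg (A.a_ne hj), if_neg (A.a_ne hj2)]
  · rw [h2 u hu, sub_eq_add_neg]

theorem lt_of_birth_le {q u : V} {i j : Fin 3} (hi : i ≠ 2) (hj : j ≠ 2) (hij : i ≠ j)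
    (h : A.birth u ≤ A.depth q) (hqi : A.g q i < A.g u i) : A.g u j < A.g q j := by
  by_contra! hle
  exact absurd (depth_lt_birth hi hj hij hqi
    (A.lt_of_le (A.ne_of_lt hqi) hle)).2 (not_lt.2 h)

theorem out_le_of_lt {p q : V} {i j k : Fin 3} (hij : i ≠ j) (hik : i ≠ k) (hjk : j ≠ k)
    (hj : A.g q j < A.g p j) (hk : A.g q k < A.g p k) : A.g (A.out i p) i ≤ A.g q i := by
  refine out_le fun m hm => ?_
  rcases fin_three_cases hij hik hjk m with rfl | rfl | rfl
  exacts [absurd rfl hm, hj, hk]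

namespace IsStair

variable {F : V → ℝ} {i j : Fin 3}

/-- A point removed by `p` is lower than the neighbour `A.out i p` of `p` by a step at least. -/
theorem add_gap_le_out (h : A.IsStair i F) {u : V} (hu : ¬ A.IsAxisPoint u) :
    F u + A.gap u ≤ F (A.out i (A.out 2 u)) := by
  rw [h.rec_eq u hu, gap_eq_step hu]
  have h1 : 1 ≤ {c ∈ A.children (A.out 2 u) | A.g u i ≤ A.g c i}.ncard :=
    (Set.ncard_pos (Set.toFinite _)).2 ⟨u, ⟨hu, rfl⟩, le_rfl⟩
  have h2 : (1 : ℝ) ≤ ({c ∈ A.children (A.out 2 u) | A.g u i ≤ A.g c i}.ncard : ℝ) := by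
    exact_mod_cast h1
  nlinarith [step_pos (A := A) (A.out 2 u)]

theorem add_gap_le_of_axis (h : A.IsStair i F) (hi : i ≠ 2) {u w : V} (hu : A.IsAxisPoint u)
    (hw : A.IsAxisPoint w) (hlt : A.g u i < A.g w i) : F u + A.gap u ≤ F w := by
  have hgap : A.gap u = Nat.card V := by rw [gap, birth_axis hu, pow_zero, mul_one]
  have hc := card_pos A
  rw [hgap]
  obtain ⟨m, rfl⟩ := hu
  obtain ⟨l, rfl⟩ := hw
  have hm : m ≠ i := by rintro rfl; exact absurd hlt (not_lt.2 (A.top m _))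
  have hml : m ≠ l := by rintro rfl; exact lt_irrefl _ hlt
  by_cases hl : l = i
  · subst hl
    by_cases hm2 : m = 2
    · subst hm2; rw [h.base, h.base_two]; linarith
    · rw [h.base, h.base_of_ne m hm hm2]; linarith
  · by_cases hl2 : l = 2
    · subst hl2
      rw [h.base_two, h.base_of_ne m hm hml]; linarith
    · have hm2 : m = 2 := by omega
      subst hm2
      exact absurd hlt (lt_asymm (A.low_axis l i 2 hl (Ne.symm hi) (by omega)))

/-- Along every staircase of the sweep the heights increase, with prescribed gaps. -/
theorem add_gap_le (h : A.IsStair i F) (hi : i ≠ 2) {u w : V} (huw : A.birth u ≤ A.depth w)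
    (hwu : A.birth w ≤ A.depth u) (hlt : A.g u i < A.g w i) : F u + A.gap u ≤ F w := by
  induction hn : max (A.birth u) (A.birth w) using Nat.strong_induction_on generalizing u w with
  | _ n ih =>
  subst hn
  obtain ⟨j, hij, hj2'⟩ := exists_third i 2
  have hj2 := hj2'.symm
  rcases lt_trichotomy (A.birth u) (A.birth w) with hb | hb | hb
  · -- `w` appears after `u`, when the sweep passes `p`; compare both with `p`
    have hw : ¬ A.IsAxisPoint w := fun hw => by rw [birth_axis hw] at hb; exact Nat.not_lt_zero _ hb
    have hex := exists_below_out_two hw hi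
    have hbw := birth_of_not_axis hw
    have hpw := fun {m} => out_two_lt hw (i := m)
    have hrec := h.rec_eq w hw
    generalize A.out 2 w = p at *
    have hup : A.birth u ≤ A.depth p := by omega
    have hui : A.g u i < A.g p i := by
      by_contra! hle
      have hne : p ≠ u := by rintro rfl; omega
      have h1 := lt_of_birth_le hi hj2 hij hup (A.lt_of_le hne hle)
      have h2 := (depth_lt_birth hi hj2 hij hlt (h1.trans (hpw hj2))).2
      omega
    have hbp := birth_le_depth (A := A) p
    have h1 := ih _ (by omega) hup (by omega) hui rfl
    have hrp : A.depth p < A.depth (A.out i p) := depth_lt_depth (out_lt hex 2 hi.symm)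
    have hbr := birth_out_le hi hex
    have h2 := ih _ (by omega) (u := p) (w := A.out i p) (by omega) hbr (lt_out hex) rfl
    have h3 := step_mul_ncard_lt_gap (A := A) p
    have h4 := step_mul_ncard_sep_le (A := A) p (fun c => A.g w i ≤ A.g c i)
    linarith
  · by_cases hu : A.IsAxisPoint u
    · refine h.add_gap_le_of_axis hi hu ?_ hlt
      by_contra hw
      rw [birth_axis hu, birth_of_not_axis hw] at hb
      omega
    · have hw : ¬ A.IsAxisPoint w := fun hw => by
        rw [birth_axis hw, birth_of_not_axis hu] at hb; omega
      -- `u` and `w` appear at the same time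
      have hp : A.out 2 u = A.out 2 w := depth_injective (A := A) (by
        rw [birth_of_not_axis hu, birth_of_not_axis hw] at hb; omega)
      rw [h.rec_eq u hu, h.rec_eq w hw, gap_eq_step hu, ← hp]
      have hcard : {c ∈ A.children (A.out 2 u) | A.g w i ≤ A.g c i}.ncard + 1 ≤
          {c ∈ A.children (A.out 2 u) | A.g u i ≤ A.g c i}.ncard := by
        refine Set.ncard_lt_ncard ⟨fun c hc => ⟨hc.1, hlt.le.trans hc.2⟩, fun hsup => ?_⟩
          (Set.toFinite _)
        exact absurd (hsup (show u ∈ _ from ⟨⟨hu, rfl⟩, le_rfl⟩)).2 (not_le.2 hlt)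
      have hcard' : ({c ∈ A.children (A.out 2 u) | A.g w i ≤ A.g c i}.ncard : ℝ) + 1 ≤
          ({c ∈ A.children (A.out 2 u) | A.g u i ≤ A.g c i}.ncard : ℝ) := by exact_mod_cast hcard
      nlinarith [step_pos (A := A) (A.out 2 u)]
  · -- `u` appears after `w`, when the sweep passes `p`; the point `A.out i p` lies between
    have hu : ¬ A.IsAxisPoint u := fun hu => by rw [birth_axis hu] at hb; exact Nat.not_lt_zero _ hb
    have hex := exists_below_out_two hu hi
    have hbu := birth_of_not_axis hu
    have hpu := fun {m} => out_two_lt hu (i := m)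
    have h1 := h.add_gap_le_out hu
    generalize A.out 2 u = p at *
    have hwp : A.birth w ≤ A.depth p := by omega
    have hw2 : A.g w 2 < A.g p 2 := lt_of_depth_lt (by omega)
    have hwj : A.g w j < A.g p j := lt_of_birth_le hi hj2 hij hwp ((hpu hi).trans hlt)
    have hle := out_le_of_lt hij hi hj2 hwj hw2
    have hrp : A.depth p < A.depth (A.out i p) := depth_lt_depth (out_lt hex 2 hi.symm)
    have hbr := birth_out_le hi hex
    by_cases e : A.out i p = w
    · rwa [e] at h1
    · have h2 := ih _ (by omega) (u := A.out i p) (w := w) (by omega) (by omega)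
        (A.lt_of_le e hle) rfl
      have h3 := gap_pos (A := A) (A.out i p)
      linarith

theorem lt_of_coexist (h : A.IsStair i F) (hi : i ≠ 2) {u w : V} (huw : A.birth u ≤ A.depth w)
    (hwu : A.birth w ≤ A.depth u) (hlt : A.g u i < A.g w i) : F u < F w := by
  have h1 := h.add_gap_le hi huw hwu hlt
  have h2 := gap_pos (A := A) u
  linarith

theorem add_gap_le_out' (h : A.IsStair i F) (hi : i ≠ 2) {p : V}
    (hex : ∃ q, ∀ j, j ≠ i → A.g q j < A.g p j) : F p + A.gap p ≤ F (A.out i p) := by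
  have h1 : A.depth p < A.depth (A.out i p) := depth_lt_depth (out_lt hex 2 hi.symm)
  have h2 := birth_le_depth (A := A) p
  exact h.add_gap_le hi (by omega) (birth_out_le hi hex) (lt_out hex)

theorem out_two_lt (h : A.IsStair i F) (hi : i ≠ 2) {u : V} (hu : ¬ A.IsAxisPoint u) :
    F (A.out 2 u) < F u := by
  have hex := exists_below_out_two hu hi
  have h1 := h.add_gap_le_out' hi hex
  have h2 := step_mul_ncard_lt_gap (A := A) (A.out 2 u)
  have h3 := step_mul_ncard_sep_le (A := A) (A.out 2 u) (fun c => A.g u i ≤ A.g c i)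
  rw [h.rec_eq u hu]
  linarith

theorem out_lt_of_ne (h : A.IsStair j F) (hi : i ≠ 2) (hj : j ≠ 2) (hij : i ≠ j) {p : V}
    (hex : ∃ q, ∀ j, j ≠ i → A.g q j < A.g p j) : F (A.out i p) < F p := by
  have h1 : A.depth p < A.depth (A.out i p) := depth_lt_depth (out_lt hex 2 hi.symm)
  have h2 := birth_le_depth (A := A) p
  exact h.lt_of_coexist hj (birth_out_le hi hex) (by omega) (out_lt hex j hij.symm)

/-- The points on the near side of `A.out i p` that lie below `p` are placed, in the other
direction `j`, at least as far out as the first of the points removed by `p`. -/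
theorem le_of_lt_out (h : A.IsStair j F) (hi : i ≠ 2) (hj : j ≠ 2) (hij : i ≠ j) {p w : V}
    (hexj : ∃ q, ∀ m, m ≠ j → A.g q m < A.g p m)
    (hwi : A.g w i < A.g (A.out i p) i) (hw2 : A.g w 2 < A.g p 2) :
    F (A.out j p) - A.step p * ((A.children p).ncard : ℝ) ≤ F w := by
  induction hn : A.depth w using Nat.strong_induction_on generalizing w with
  | _ n ih =>
  subst hn
  have hdw := depth_lt_depth hw2
  rcases lt_trichotomy (A.birth w) (A.depth p + 1) with hb | hb | hb
  · have hwp : A.g w i < A.g p i := by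
      by_contra! hle
      have hne : p ≠ w := (A.ne_of_lt hw2).symm
      have h1 := lt_of_birth_le hi hj hij (by omega) (A.lt_of_le hne hle)
      exact absurd (out_le_of_lt hij hi hj h1 hw2) (not_le.2 hwi)
    have hle := out_le_of_lt hij.symm hj hi hwp hw2
    have hpos : 0 ≤ A.step p * ((A.children p).ncard : ℝ) :=
      mul_nonneg (step_pos p).le (Nat.cast_nonneg _)
    by_cases e : A.out j p = w
    · rw [e]; linarith
    · have h1 : A.depth p < A.depth (A.out j p) := depth_lt_depth (out_lt hexj 2 hj.symm)
      have h2 := birth_out_le hj hexj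
      have h3 := h.lt_of_coexist hj (u := A.out j p) (w := w) (by omega) (by omega)
        (A.lt_of_le e hle)
      linarith
  · have hw : ¬ A.IsAxisPoint w := fun hw => by rw [birth_axis hw] at hb; omega
    have hp : A.out 2 w = p := depth_injective (A := A) (by rw [birth_of_not_axis hw] at hb; omega)
    have h1 := step_mul_ncard_sep_le (A := A) p (fun c => A.g w j ≤ A.g c j)
    rw [h.rec_eq w hw, hp]
    linarith
  · have hw : ¬ A.IsAxisPoint w := fun hw => by rw [birth_axis hw] at hb; omega
    have h1 := h.out_two_lt hj hw
    rw [birth_of_not_axis hw] at hb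
    have h2 := ih _ (depth_lt_depth (lt_out_two hw))
      ((GenericAntichain.out_two_lt hw hi).trans hwi) (lt_of_depth_lt (by omega)) rfl
    linarith

end IsStair

/-- The height in direction `2` is dictated by the condition that the corners of the staircase
removed by `p` lie on the plane where the coordinates add up to `0`. -/
noncomputable def height (A : GenericAntichain V) (F : Fin 3 → V → ℝ) (p : V) : ℝ :=
  -(F 0 (A.out 0 p) + F 1 (A.out 1 p)) + A.step p * ((A.children p).ncard : ℝ)

theorem height_eq (F : Fin 3 → V → ℝ) (p : V) {i j : Fin 3} (hi : i ≠ 2) (hj : j ≠ 2)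
    (hij : i ≠ j) : A.height F p =
      -(F i (A.out i p) + F j (A.out j p)) + A.step p * ((A.children p).ncard : ℝ) := by
  have : (i = 0 ∧ j = 1) ∨ (i = 1 ∧ j = 0) := by omega
  rcases this with ⟨rfl, rfl⟩ | ⟨rfl, rfl⟩
  · rfl
  · rw [height, add_comm (F 0 _)]

/-- The points removed by `p` form a staircase. -/
theorem children_lt_iff {p c c' : V} (hc : c ∈ A.children p) (hc' : c' ∈ A.children p)
    {i j : Fin 3} (hi : i ≠ 2) (hj : j ≠ 2) (hij : i ≠ j) :
    A.g c i < A.g c' i ↔ A.g c' j < A.g c j := by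
  have main : ∀ {i j : Fin 3}, i ≠ 2 → j ≠ 2 → i ≠ j → ∀ {c c' : V}, c ∈ A.children p →
      c' ∈ A.children p → A.g c i < A.g c' i → A.g c' j < A.g c j := by
    intro i j hi hj hij c c' hc hc' hlt
    refine lt_of_birth_le hi hj hij ?_ hlt
    have := depth_lt_depth (lt_out_two hc.1)
    rw [birth_of_not_axis hc'.1, hc'.2]
    rw [hc.2] at this
    omega
  exact ⟨main hi hj hij hc hc', main hj hi hij.symm hc' hc⟩

/-- The recursion places consecutive points of a staircase so that their corners are at the height
of the point removing them. -/
theorem height_out_two {F : Fin 3 → V → ℝ} (h0 : A.IsStair 0 (F 0)) (h1 : A.IsStair 1 (F 1))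
    {u : V} (hu : ¬ A.IsAxisPoint u) :
    A.height F (A.out 2 u) = -(F 0 u + F 1 u) - A.step (A.out 2 u) := by
  have huc : u ∈ A.children (A.out 2 u) := ⟨hu, rfl⟩
  have hunion : {c ∈ A.children (A.out 2 u) | A.g u 0 ≤ A.g c 0} ∪
      {c ∈ A.children (A.out 2 u) | A.g u 1 ≤ A.g c 1} = A.children (A.out 2 u) := by
    ext c
    refine ⟨fun hc => hc.elim And.left And.left, fun hc => ?_⟩
    rcases le_or_gt (A.g u 0) (A.g c 0) with h | h
    · exact Or.inl ⟨hc, h⟩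
    · exact Or.inr ⟨hc, ((children_lt_iff hc huc (by decide) (by decide) (by decide)).1 h).le⟩
  have hinter : {c ∈ A.children (A.out 2 u) | A.g u 0 ≤ A.g c 0} ∩
      {c ∈ A.children (A.out 2 u) | A.g u 1 ≤ A.g c 1} = {u} := by
    ext c
    refine ⟨fun ⟨⟨hc, hc0⟩, _, hc1⟩ => ?_, ?_⟩
    · by_contra hne
      have := (children_lt_iff huc hc (i := 0) (j := 1) (by decide) (by decide) (by decide)).1
        (A.lt_of_le (Ne.symm hne) hc0)
      exact absurd hc1 (not_le.2 this)
    · rintro rfl; exact ⟨⟨huc, le_rfl⟩, huc, le_rfl⟩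
  have hcard := Set.ncard_union_add_ncard_inter {c ∈ A.children (A.out 2 u) | A.g u 0 ≤ A.g c 0}
    {c ∈ A.children (A.out 2 u) | A.g u 1 ≤ A.g c 1} (Set.toFinite _) (Set.toFinite _)
  rw [hunion, hinter, Set.ncard_singleton] at hcard
  have hcard' : ((A.children (A.out 2 u)).ncard : ℝ) + 1 =
      ({c ∈ A.children (A.out 2 u) | A.g u 0 ≤ A.g c 0}.ncard : ℝ) +
      ({c ∈ A.children (A.out 2 u) | A.g u 1 ≤ A.g c 1}.ncard : ℝ) := by exact_mod_cast hcard
  rw [height, h0.rec_eq u hu, h1.rec_eq u hu]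
  linear_combination A.step (A.out 2 u) * hcard'

theorem height_lt_out_two {F : Fin 3 → V → ℝ} (h0 : A.IsStair 0 (F 0)) (h1 : A.IsStair 1 (F 1))
    {u : V} (hu : ¬ A.IsAxisPoint u) : A.height F u < A.height F (A.out 2 u) := by
  rw [height_out_two h0 h1 hu, height]
  have e0 := h0.add_gap_le_out' (by decide) (exists_below hu 0)
  have e1 := h1.add_gap_le_out' (by decide) (exists_below hu 1)
  have e2 := step_mul_ncard_lt_gap (A := A) u
  have e3 := gap_eq_step hu
  linarith

theorem height_out_lt {F : Fin 3 → V → ℝ} {i j : Fin 3} (hi : i ≠ 2) (hj : j ≠ 2) (hij : i ≠ j)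
    (hFi : A.IsStair i (F i)) (hFj : A.IsStair j (F j)) {p : V}
    (hex : ∃ q, ∀ m, m ≠ i → A.g q m < A.g p m) (hexj : ∃ q, ∀ m, m ≠ j → A.g q m < A.g p m)
    (hq : ¬ A.IsAxisPoint (A.out i p)) : A.height F (A.out i p) < A.height F p := by
  rw [height_eq F p hi hj hij, height_eq F (A.out i p) hi hj hij]
  have hexq := exists_below hq j
  have e1 := hFi.add_gap_le_out' hi (exists_below hq i)
  have e2 := step_mul_ncard_lt_gap (A := A) (A.out i p)
  have e3 := hFj.le_of_lt_out hi hj hij hexj (w := A.out j (A.out i p))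
    (out_lt hexq i hij) ((out_lt hexq 2 hj.symm).trans (out_lt hex 2 hi.symm))
  linarith

/-- The height of the point labelled `i` in a triple, measured from the neighbour `A.out i (t 2)`
of the point `t 2` at which the triple is completed. -/
theorem IsStair.eq_of_isTriple {i j : Fin 3} (hi : i ≠ 2) (hj : j ≠ 2) (hij : i ≠ j) {F : V → ℝ}
    (hF : A.IsStair i F) {t : Fin 3 → V} (ht : A.IsTriple t) :
    F (t i) = F (A.out i (t 2)) -
      A.step (t 2) * ({c ∈ A.children (t 2) | A.g (t i) i ≤ A.g c i}.ncard : ℝ) := by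
  have hex : ∃ q, ∀ m, m ≠ i → A.g q m < A.g (t 2) m := by
    refine exists_below' ?_ ?_ hi <;> intro e
    · exact ht.not_null 2 ⟨0, by decide, e⟩
    · exact ht.not_null 2 ⟨1, by decide, e⟩
  have hne : t i ≠ t 2 := fun e => hi (ht.injective e)
  rcases A.lt_or_lt hne j with hlt | hlt
  · -- no point between `t 2` and `t i`: `t i` is the old neighbour of `t 2`
    have hle := out_le_of_lt hij hi hj hlt (ht.lt 2 i hi)
    have hr := out_lt hex
    have e : A.out i (t 2) = t i := by
      obtain ⟨m, hm⟩ := ht.mem (A.out i (t 2)) fun m => by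
        rcases fin_three_cases hij hi hj m with rfl | rfl | rfl
        · exact hle
        · exact (hr _ hij.symm).le.trans (ht.le _ _)
        · exact (hr _ hi.symm).le
      rcases fin_three_cases hij hi hj m with rfl | rfl | rfl
      · exact hm
      · exact absurd (hm ▸ hr _ hij.symm) (not_lt.2 (ht.le _ _))
      · exact absurd (hm ▸ hr _ hij.symm) (lt_irrefl _)
    have hempty : {c ∈ A.children (t 2) | A.g (t i) i ≤ A.g c i} = ∅ := by
      rw [Set.eq_empty_iff_forall_notMem]
      rintro c ⟨hc, hci⟩
      have hcj := GenericAntichain.out_two_lt hc.1 hj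
      rw [hc.2] at hcj
      have hne' : t i ≠ c := A.ne_of_lt (hlt.trans hcj)
      have h1 := (depth_lt_birth hi hj hij (A.lt_of_le hne' hci) (hlt.trans hcj)).2
      have h2 := depth_lt_depth (ht.lt 2 i hi)
      rw [birth_of_not_axis hc.1, hc.2] at h1
      omega
    rw [hempty, e, Set.ncard_empty, Nat.cast_zero, mul_zero, sub_zero]
  · obtain ⟨hax, -⟩ := depth_lt_birth hi hj hij (ht.lt i 2 hi.symm) hlt
    have hr := fun {m} => GenericAntichain.out_two_lt hax (i := m)
    have e : A.out 2 (t i) = t 2 := by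
      obtain ⟨m, hm⟩ := ht.mem (A.out 2 (t i)) fun m => by
        rcases fin_three_cases hij hi hj m with rfl | rfl | rfl
        · exact (hr hi).le
        · exact (hr hj).le.trans (ht.le _ _)
        · exact out_le_of_lt hi.symm hj.symm hij (ht.lt i _ hi.symm) hlt
      rcases fin_three_cases hij hi hj m with rfl | rfl | rfl
      · exact absurd (hm ▸ hr hi) (lt_irrefl _)
      · exact absurd (hm ▸ hr hj) (not_lt.2 (ht.le _ _))
      · exact hm
    rw [hF.rec_eq _ hax, e]

/-- In a triple, the points removed by `t 2` are shared out between the other two points. -/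
theorem ncard_children_of_isTriple {t : Fin 3 → V} (ht : A.IsTriple t) :
    (A.children (t 2)).ncard = {c ∈ A.children (t 2) | A.g (t 0) 0 ≤ A.g c 0}.ncard +
      {c ∈ A.children (t 2) | A.g (t 1) 1 ≤ A.g c 1}.ncard := by
  have hdepth : ∀ {c}, c ∈ A.children (t 2) → A.birth c = A.depth (t 2) + 1 := fun {c} hc => by
    rw [birth_of_not_axis hc.1, hc.2]
  rw [← Set.ncard_union_eq ?_ (Set.toFinite _) (Set.toFinite _)]
  · congr 1
    ext c
    refine ⟨fun hc => ?_, fun hc => hc.elim And.left And.left⟩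
    by_contra hno
    have h0 : A.g c 0 < A.g (t 0) 0 := by
      by_contra! h; exact hno (Or.inl ⟨hc, h⟩)
    have h1 : A.g c 1 < A.g (t 1) 1 := by
      by_contra! h; exact hno (Or.inr ⟨hc, h⟩)
    have h2 : A.g c 2 < A.g (t 2) 2 := by
      have := lt_out_two hc.1
      rwa [hc.2] at this
    obtain ⟨m, rfl⟩ := ht.mem c fun m => by
      rcases fin_three_cases (i := 0) (j := 1) (k := 2) (by decide) (by decide) (by decide) m with
        rfl | rfl | rfl
      exacts [h0.le, h1.le, h2.le]
    rcases fin_three_cases (i := 0) (j := 1) (k := 2) (by decide) (by decide) (by decide) m with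
      rfl | rfl | rfl
    exacts [lt_irrefl _ h0, lt_irrefl _ h1, lt_irrefl _ h2]
  · rw [Set.disjoint_left]
    rintro c ⟨hc, hc0⟩ ⟨-, hc1⟩
    -- otherwise `t 0` would have removed `c` before `t 2`
    have hlt1 : A.g (t 0) 1 < A.g c 1 := (ht.lt 1 0 (by decide)).trans_le hc1
    have h1 := (depth_lt_birth (by decide) (by decide) (by decide)
      (A.lt_of_le (A.ne_of_lt hlt1) hc0) hlt1).2
    have h2 := depth_lt_depth (ht.lt 2 0 (by decide))
    rw [hdepth hc] at h1
    omega

/-- Every generic antichain can be deformed, without changing its minimal pairs and triples, so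
that all corners `(f (t 0) 0, f (t 1) 1, f (t 2) 2)` of triples lie on one plane. Only the order of
coordinates along minimal pairs has to be kept. -/
theorem exists_coplanar (A : GenericAntichain V) :
    ∃ f : V → Fin 3 → ℝ, (∀ t, A.IsTriple t → f (t 0) 0 + f (t 1) 1 + f (t 2) 2 = 0) ∧
      ∀ p q, A.IsEdge p q → ∀ i, A.g p i < A.g q i → ¬ A.Null p i → f p i < f q i := by
  have hF : ∀ i : Fin 3, ∃ F : V → ℝ, i ≠ 2 → A.IsStair i F := fun i => by
    by_cases hi : i = 2
    · exact ⟨fun _ => 0, fun h => absurd hi h⟩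
    · obtain ⟨F, hF⟩ := A.exists_isStair hi
      exact ⟨F, fun _ => hF⟩
  choose F hF using hF
  have h0 := hF 0 (by decide)
  have h1 := hF 1 (by decide)
  have e2 : ∀ p, (fun p i => if i = 2 then A.height F p else F i p : V → Fin 3 → ℝ) p 2 =
      A.height F p := fun p => if_pos rfl
  have ei : ∀ p i, i ≠ 2 → (fun p i => if i = 2 then A.height F p else F i p : V → Fin 3 → ℝ) p i =
      F i p := fun p i hi => if_neg hi
  refine ⟨fun p i => if i = 2 then A.height F p else F i p, fun t ht => ?_,
    fun p q hpq m hm hnull => ?_⟩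
  · generalize (fun p i => if i = 2 then A.height F p else F i p : V → Fin 3 → ℝ) = f at e2 ei
    rw [e2, ei _ _ (by decide), ei _ _ (by decide), height,
      h0.eq_of_isTriple (j := 1) (by decide) (by decide) (by decide) ht,
      h1.eq_of_isTriple (j := 0) (by decide) (by decide) (by decide) ht,
      ncard_children_of_isTriple ht]
    push_cast
    ring
  · generalize (fun p i => if i = 2 then A.height F p else F i p : V → Fin 3 → ℝ) = f at e2 ei
    -- every minimal pair is an outgoing edge `P`, `A.out k P`
    have main : ∀ {P Q : V}, A.IsEdge P Q → ∀ {i j k : Fin 3}, i ≠ j → i ≠ k → j ≠ k →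
        A.g Q i < A.g P i → A.g Q j < A.g P j → A.g P k < A.g Q k →
        (A.g P m < A.g Q m → ¬ A.Null P m → f P m < f Q m) ∧
        (A.g Q m < A.g P m → ¬ A.Null Q m → f Q m < f P m) := by
      clear hm hnull hpq p q
      intro P Q hPQ i j k hij hik hjk hi hj hk
      have hQ : ∀ n, n ≠ k → A.g Q n < A.g P n := fun n hn => by
        rcases fin_three_cases hij hik hjk n with rfl | rfl | rfl
        exacts [hi, hj, absurd rfl hn]
      have hout := hPQ.eq_out hQ
      by_cases hk2 : k = 2
      · subst hk2
        have hP := (depth_lt_birth hik hjk hij hi hj).1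
        subst hout
        constructor
        · intro hm _
          have hm2 : m = 2 := by
            by_contra h; exact lt_asymm hm (hQ m h)
          subst hm2
          rw [e2, e2]
          exact height_lt_out_two h0 h1 hP
        · intro hm _
          have hm2 : m ≠ 2 := by rintro rfl; exact lt_asymm hm hk
          rw [ei _ _ hm2, ei _ _ hm2]
          exact (hF m hm2).out_two_lt hm2 hP
      · obtain ⟨l, hkl, hl2'⟩ := exists_third k 2
        have hl2 := hl2'.symm
        have hQ2 := hQ 2 (Ne.symm hk2)
        constructor
        · intro hm hnull
          have hmk : m = k := by
            by_contra h; exact lt_asymm hm (hQ m h)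
          subst hmk
          rw [ei _ _ hk2, ei _ _ hk2, hout]
          have h2 := (hF m hk2).add_gap_le_out' hk2 (p := P) ⟨Q, hQ⟩
          have h3 := gap_pos (A := A) P
          linarith
        · intro hm hnull
          have hmk : m ≠ k := by rintro rfl; exact lt_asymm hm hk
          by_cases hm2 : m = 2
          · subst hm2
            have hP : ¬ A.Null P 2 := A.not_null_of_lt hnull hm.le
            have hQax : ¬ A.IsAxisPoint Q := by
              rintro ⟨n, rfl⟩
              by_cases hn : n = 2
              · subst hn; exact absurd hm (not_lt.2 (A.top 2 P))
              · exact hnull ⟨n, hn, rfl⟩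
            have hP0 : P ≠ A.a 0 := fun e => hP ⟨0, by decide, e⟩
            have hP1 : P ≠ A.a 1 := fun e => hP ⟨1, by decide, e⟩
            rw [e2, e2]
            subst hout
            exact height_out_lt hk2 hl2 hkl (hF k hk2) (hF l hl2) (exists_below' hP0 hP1 hk2)
              (exists_below' hP0 hP1 hl2) hQax
          · rw [ei _ _ hm2, ei _ _ hm2, hout]
            exact (hF m hm2).out_lt_of_ne hk2 hm2 (Ne.symm hmk) ⟨Q, hQ⟩
    obtain ⟨i, j, k, hij, hik, hjk, ⟨hi, hj, hk⟩ | ⟨hi, hj, hk⟩⟩ := hpq.exists_orientation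
    · exact (main hpq hij hik hjk hi hj hk).1 hm hnull
    · exact (main hpq.symm hij hik hjk hi hj hk).2 hm hnull

end GenericAntichain

end MinkowskiVoronoi

/-! ### The faces of the diagram -/

namespace MinkowskiVoronoi

namespace GenericAntichain

variable {V : Type*} (A : GenericAntichain V)

/-- `f` keeps the order of coordinates along minimal pairs, except for null coordinates. -/
def IsMono (f : V → Fin 3 → ℝ) : Prop :=
  ∀ p q, A.IsEdge p q → ∀ i, A.g p i < A.g q i → ¬ A.Null p i → f p i < f q i

/-- The face of the point `p` in the diagram with heights `f`, a hexagon in the plane where the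
coordinates of `X` add up to `0`. It is bounded from below by the heights of `p` itself and from
above by those of the points lower than `p` in the other two coordinates. The faces of axis points
are unbounded in their null coordinates. -/
def Hex (f : V → Fin 3 → ℝ) (p : V) (X : Fin 3 → ℝ) : Prop :=
  (∀ i, ¬ A.Null p i → f p i ≤ X i) ∧ ∀ i w, (∀ j, j ≠ i → A.g w j < A.g p j) → X i ≤ f w i

variable {A} {f : V → Fin 3 → ℝ}

/-- If no point in the box of `p` and `w` is lower than `p` in coordinate `i`, then minimal pairs
inside this box lead down from `w` to `p`. -/
theorem IsMono.lt_of_box [Finite V] (hf : A.IsMono f) {p w : V} {i : Fin 3} (hne : p ≠ w)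
    (hp : ¬ A.Null p i)
    (hbox : ∀ q, (∀ m, A.g q m ≤ max (A.g p m) (A.g w m)) → A.g p i ≤ A.g q i) :
    f p i < f w i := by
  induction hn : {x | A.g x i < A.g w i}.ncard using Nat.strong_induction_on generalizing w with
  | _ n ih =>
  subst hn
  obtain ⟨q, hwq, hq⟩ := exists_isEdge hne
  have hpw := hbox w fun m => le_max_right _ _
  have hqi := hq i
  rw [max_eq_right hpw] at hqi
  have hlt := A.lt_of_le hwq.ne.symm hqi
  have hpq := hbox q hq
  have hfq := hf q w hwq.symm i hlt (A.not_null_of_lt hp hpq)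
  by_cases e : p = q
  · rwa [e]
  · refine lt_trans (ih _ ?_ e (fun x hx => ?_) rfl) hfq
    · refine Set.ncard_lt_ncard ⟨fun x hx => lt_trans hx hlt, fun hsup => ?_⟩ (Set.toFinite _)
      exact lt_irrefl (A.g q i) (hsup (show q ∈ {x | A.g x i < A.g w i} from hlt))
    · exact hbox x fun m => (hx m).trans (max_le (le_max_left _ _) (hq m))

theorem IsMono.lt_of_isTriple [Finite V] (hf : A.IsMono f) {t : Fin 3 → V} (ht : A.IsTriple t)
    {i : Fin 3} {w : V} (hne : t i ≠ w) (hw : ∀ l, l ≠ i → A.g w l < A.g (t l) l) :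
    f (t i) i < f w i := by
  refine hf.lt_of_box hne (ht.not_null i) fun q hq => ?_
  by_contra! hlt
  have hql : ∀ l, l ≠ i → A.g q l < A.g (t l) l := fun l hl =>
    (hq l).trans_lt (max_lt (ht.lt l i hl.symm) (hw l hl))
  obtain ⟨m, rfl⟩ := ht.mem q fun l => by
    by_cases hl : l = i
    · subst hl; exact hlt.le
    · exact (hql l hl).le
  by_cases hm : m = i
  · subst hm; exact lt_irrefl _ hlt
  · exact lt_irrefl _ (hql m hm)

/-- Triples have their corners on the faces of their points. -/
theorem IsMono.hex_corner [Finite V] (hf : A.IsMono f) {t : Fin 3 → V} (ht : A.IsTriple t)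
    (m : Fin 3) : A.Hex f (t m) fun i => f (t i) i := by
  refine ⟨fun i hi => ?_, fun i w hw => ?_⟩
  · by_cases hmi : m = i
    · rw [hmi]
    · exact (hf _ _ (ht.isEdge hmi) i (ht.lt i m hmi) hi).le
  · by_cases e : t i = w
    · exact (congrArg (fun x => f x i) e).le
    · exact (hf.lt_of_isTriple ht e fun l hl => (hw l hl).trans_le (ht.le l m)).le

/-- The corner of a triple lies on no face except those of its three points. -/
theorem IsMono.exists_eq_of_hex_corner [Finite V] (hf : A.IsMono f) {t : Fin 3 → V}
    (ht : A.IsTriple t) {u : V} (hu : A.Hex f u fun i => f (t i) i) : ∃ m, u = t m := by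
  by_contra! hne
  have hcmp : ∀ m, A.g u m < A.g (t m) m ∨ A.g (t m) m < A.g u m := fun m => A.lt_or_lt (hne m) m
  -- `u` is not higher than the corner in two coordinates
  have htwo : ∀ {i j k : Fin 3}, i ≠ j → i ≠ k → j ≠ k → A.g (t i) i < A.g u i →
      A.g (t j) j < A.g u j → False := by
    intro i j k hij hik hjk hi hj
    have h1 : f (t k) k ≤ f (t i) k := hu.2 k (t i) fun l hl => by
      rcases fin_three_cases hij hik hjk l with rfl | rfl | rfl
      exacts [hi, (ht.lt l _ hij).trans hj, absurd rfl hl]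
    have hnull : ¬ A.Null (t i) k := by
      rintro ⟨m, hm, e⟩
      by_cases hmi : m = i
      · subst hmi
        rw [e] at hi
        exact absurd hi (not_lt.2 (A.top _ u))
      · exact ht.not_null i ⟨m, hmi, e⟩
    exact absurd (hf _ _ (ht.isEdge hik) k (ht.lt k i hik) hnull) (not_lt.2 h1)
  have hone : ∀ {i j k : Fin 3}, i ≠ j → i ≠ k → j ≠ k → A.g (t i) i < A.g u i → False := by
    intro i j k hij hik hjk hi
    have hj := (hcmp j).resolve_right fun h => htwo hij hik hjk hi h
    have hk := (hcmp k).resolve_right fun h => htwo hik hij hjk.symm hi h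
    have h1 := hf.lt_of_isTriple ht (hne i).symm fun l hl => by
      rcases fin_three_cases hij hik hjk l with rfl | rfl | rfl
      exacts [absurd rfl hl, hj, hk]
    exact absurd (hu.1 i (A.not_null_of_lt (ht.not_null i) hi.le)) (not_le.2 h1)
  obtain ⟨m, hm⟩ := ht.mem u fun i => by
    by_contra! hi
    obtain ⟨j, k, hjk, hji, hki⟩ := exists_two_ne i
    exact hone hji.symm hki.symm hjk hi
  exact hne m hm

/-- Two triples sharing the points `t j = t' i` and `t k = t' k`. Passing from `t` to `t'`, the
`i`-th size decreases, the `j`-th one increases and the `k`-th one does not change. -/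
structure IsFlip (A : GenericAntichain V) (t t' : Fin 3 → V) (i j k : Fin 3) : Prop where
  left : A.IsTriple t
  right : A.IsTriple t'
  ij : i ≠ j
  ik : i ≠ k
  jk : j ≠ k
  eq_left : t' i = t j
  eq_right : t' k = t k

theorem IsFlip.symm {t t' : Fin 3 → V} {i j k : Fin 3} (h : A.IsFlip t t' i j k) :
    A.IsFlip t' t j i k :=
  ⟨h.right, h.left, h.ij.symm, h.jk, h.ik, h.eq_left.symm, h.eq_right.symm⟩

/-- The interior points of a finite edge lie on the faces of its two points only. -/
theorem IsFlip.eq_or_eq_of_hex [Finite V] (hf : A.IsMono f) {t t' : Fin 3 → V} {i j k : Fin 3}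
    (h : A.IsFlip t t' i j k) {X : Fin 3 → ℝ} (hi : f (t j) i < X i) (hi' : X i < f (t i) i)
    (hj : f (t j) j < X j) (hj' : X j < f (t' j) j) (hk : X k = f (t k) k) {u : V}
    (hu : A.Hex f u X) : u = t j ∨ u = t k := by
  obtain ⟨ht, ht', hij, hik, hjk, e1, e2⟩ := h
  by_contra! hne
  have hpi : ¬ A.Null (t j) i := e1 ▸ ht'.not_null i
  have hpj : ¬ A.Null (t j) j := ht.not_null j
  have hpk : ¬ A.Null (t j) k := by
    rintro ⟨m, hm, e⟩
    by_cases hmi : m = i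
    · exact hpj ⟨m, hmi ▸ hij, e⟩
    · exact hpi ⟨m, hmi, e⟩
  have hpqk : A.g (t j) k < A.g (t k) k := ht.lt k j hjk
  rcases A.lt_or_lt hne.2 k with huk | huk
  · rcases A.lt_or_lt hne.1 i with hui | hui <;> rcases A.lt_or_lt hne.1 j with huj | huj
    · rcases (ht.isEdge hjk).mem u fun m => by
        rcases fin_three_cases hij hik hjk m with rfl | rfl | rfl
        exacts [hui.le.trans (le_max_left _ _), huj.le.trans (le_max_left _ _),
          huk.le.trans (le_max_right _ _)] with e | e
      exacts [hne.1 e, hne.2 e]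
    · -- `u` is higher in coordinate `j` only
      have h1 := hu.1 j (A.not_null_of_lt hpj huj.le)
      by_cases e : t' j = u
      · rw [e] at hj'; linarith
      · have h2 := hf.lt_of_isTriple ht' e fun l hl => by
          rcases fin_three_cases hij hik hjk l with rfl | rfl | rfl
          exacts [e1 ▸ hui, absurd rfl hl, e2 ▸ huk]
        linarith
    · have h1 := hu.1 i (A.not_null_of_lt hpi hui.le)
      by_cases e : t i = u
      · rw [e] at hi'; linarith
      · have h2 := hf.lt_of_isTriple ht e fun l hl => by
          rcases fin_three_cases hij hik hjk l with rfl | rfl | rfl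
          exacts [absurd rfl hl, huj, huk]
        linarith
    · have h1 := hu.2 k (t j) fun l hl => by
        rcases fin_three_cases hij hik hjk l with rfl | rfl | rfl
        exacts [hui, huj, absurd rfl hl]
      have h2 := hf _ _ (ht.isEdge hjk) k hpqk hpk
      linarith
  · have hpuk := hpqk.trans huk
    rcases A.lt_or_lt hne.1 i with hui | hui
    · rcases A.lt_or_lt hne.1 j with huj | huj
      · have h1 := hu.1 k (A.not_null_of_lt (ht.not_null k) huk.le)
        have h2 := hf.lt_of_isTriple ht hne.2.symm fun l hl => by
          rcases fin_three_cases hij hik hjk l with rfl | rfl | rfl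
          exacts [hui.trans (ht.lt _ _ hij.symm), huj, absurd rfl hl]
        linarith
      · have h1 := hu.2 i (t j) fun l hl => by
          rcases fin_three_cases hij hik hjk l with rfl | rfl | rfl
          exacts [absurd rfl hl, huj, hpuk]
        linarith
    · have h1 := hu.2 j (t j) fun l hl => by
        rcases fin_three_cases hij hik hjk l with rfl | rfl | rfl
        exacts [hui, absurd rfl hl, hpuk]
      linarith

/-- An infinite edge, drawn as the ray along which the coordinate `i` increases and the coordinate
`j` decreases, lies on the faces of its two points. -/
theorem IsTriple.hex_ray [Finite V] (hf : A.IsMono f) {t : Fin 3 → V} (ht : A.IsTriple t)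
    {i j k : Fin 3} (hij : i ≠ j) (hik : i ≠ k) (hjk : j ≠ k) (hi : t i = A.a i)
    (hk : t k = A.a k) (hj : A.g (t k) j < A.g (t i) j) {X : Fin 3 → ℝ}
    (hXj : X j ≤ f (t j) j) (hXi : f (t i) i ≤ X i) (hXk : X k = f (t k) k) :
    A.Hex f (t i) X ∧ A.Hex f (t k) X := by
  have main : ∀ m, m ≠ j → t m = A.a m →
      (∀ w, ¬ ∀ l, l ≠ i → A.g w l < A.g (t m) l) → A.Hex f (t m) X := by
    intro m hmj hm hno
    obtain ⟨h1, h2⟩ := hf.hex_corner ht m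
    refine ⟨fun l hl => ?_, fun l w hw => ?_⟩
    · have := h1 l hl
      rcases fin_three_cases hij hik hjk l with rfl | rfl | rfl
      · exact this.trans hXi
      · exact absurd ⟨m, hmj, hm⟩ hl
      · rw [hXk]; exact this
    · have := h2 l w hw
      rcases fin_three_cases hij hik hjk l with rfl | rfl | rfl
      · exact absurd hw (hno w)
      · exact hXj.trans this
      · rw [hXk]; exact this
  -- the faces of the two axis points are not bounded in direction `i`
  have hlow : ∀ {w m}, m ≠ j → A.g w j < A.g (t m) j → t m = A.a m → w = A.a i ∨ w = A.a k := by
    intro w m hmj hw hm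
    have hnull : A.Null w j := by
      by_contra hc
      exact lt_asymm hw (hm ▸ A.low_of_not_null hmj hc)
    obtain ⟨l, hl, rfl⟩ := hnull
    rcases fin_three_cases hij hik hjk l with rfl | rfl | rfl
    exacts [Or.inl rfl, absurd rfl hl, Or.inr rfl]
  constructor
  · refine main i hij hi fun w hw => ?_
    rcases hlow hij (hw j hij.symm) hi with rfl | rfl
    · rw [hi] at hw; exact lt_irrefl _ (hw k hik.symm)
    · exact absurd (hw k hik.symm) (not_lt.2 (A.top k _))
  · refine main k hjk.symm hk fun w hw => ?_
    have h1 := hw j hij.symm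
    rcases hlow hjk.symm h1 hk with rfl | rfl
    · rw [hi] at hj; exact lt_asymm hj h1
    · rw [hk] at h1; exact lt_irrefl _ h1

/-- The points of an infinite edge other than its endpoint lie on no further face. -/
theorem IsTriple.eq_or_eq_of_hex_ray [Finite V] (hf : A.IsMono f) {t : Fin 3 → V}
    (ht : A.IsTriple t) {i j k : Fin 3} (hij : i ≠ j) (hik : i ≠ k) (hjk : j ≠ k)
    (hi : t i = A.a i) (hk : t k = A.a k) {X : Fin 3 → ℝ} (hXj : X j < f (t j) j)
    {u : V} (hu : A.Hex f u X) : u = t i ∨ u = t k := by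
  by_contra! hne
  have hui : A.g u i < A.g (t i) i := by rw [hi]; exact A.lt_top (hi ▸ hne.1)
  have huk : A.g u k < A.g (t k) k := by rw [hk]; exact A.lt_top (hk ▸ hne.2)
  have hnull : ¬ A.Null u j := by
    rintro ⟨l, hl, rfl⟩
    rcases fin_three_cases hij hik hjk l with rfl | rfl | rfl
    exacts [hne.1 hi.symm, hl rfl, hne.2 hk.symm]
  have h1 := hu.1 j hnull
  by_cases e : t j = u
  · rw [e] at hXj; linarith
  · have h2 := hf.lt_of_isTriple ht e fun l hl => by
      rcases fin_three_cases hij hik hjk l with rfl | rfl | rfl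
      exacts [hui, absurd rfl hl, huk]
    linarith

theorem IsTriple.exists_eq_of_lt {t : Fin 3 → V} (ht : A.IsTriple t)
    {i j k : Fin 3} (hij : i ≠ j) (hik : i ≠ k) (hjk : j ≠ k) {p q : V}
    (hi : A.g q i < A.g p i) (hj : A.g q j < A.g p j) (hp : ∃ m, p = t m) (hq : ∃ m, q = t m) :
    t k = q ∧ (t i = p ∨ t j = p) := by
  obtain ⟨m, rfl⟩ := hp
  obtain ⟨n, rfl⟩ := hq
  have hni : n ≠ i := by rintro rfl; exact absurd hi (not_lt.2 (ht.le _ _))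
  have hnj : n ≠ j := by rintro rfl; exact absurd hj (not_lt.2 (ht.le _ _))
  have hmn : m ≠ n := by rintro rfl; exact lt_irrefl _ hi
  obtain rfl : n = k := by omega
  refine ⟨rfl, ?_⟩
  rcases fin_three_cases hij hik hjk m with rfl | rfl | rfl
  exacts [Or.inl rfl, Or.inr rfl, absurd rfl hmn]

/-- The pair `t j, t k` shared by two triples lies in no third triple. -/
theorem IsFlip.eq_or_eq {t t' : Fin 3 → V} {i j k : Fin 3} (h : A.IsFlip t t' i j k)
    {s : Fin 3 → V} (hs : A.IsTriple s) (h1 : ∃ m, t j = s m) (h2 : ∃ m, t k = s m) :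
    s = t ∨ s = t' := by
  obtain ⟨ht, ht', hij, hik, hjk, e1, e2⟩ := h
  have hi : A.g (t k) i < A.g (t j) i := by rw [← e1, ← e2]; exact ht'.lt i k hik.symm
  obtain ⟨e3, e4 | e4⟩ := hs.exists_eq_of_lt hij hik hjk hi (ht.lt j k hjk.symm) h1 h2
  · exact Or.inr (hs.eq_of_eq ht' hij.symm hjk hik (e4.trans e1.symm) (e3.trans e2.symm))
  · exact Or.inl (hs.eq_of_eq ht hij hik hjk e4 e3)

theorem IsFlip.exists_eq {t t' : Fin 3 → V} {i j k : Fin 3} (h : A.IsFlip t t' i j k)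
    {l : Fin 3} (hl : l ≠ i) : ∃ m, t l = t' m := by
  rcases fin_three_cases h.ij h.ik h.jk l with rfl | rfl | rfl
  exacts [absurd rfl hl, ⟨i, h.eq_left.symm⟩, ⟨_, h.eq_right.symm⟩]

theorem IsFlip.ne {t t' : Fin 3 → V} {i j k : Fin 3} (h : A.IsFlip t t' i j k) : t ≠ t' := by
  rintro rfl
  exact h.ij (h.left.injective h.eq_left)

theorem IsFlip.lt {t t' : Fin 3 → V} {i j k : Fin 3} (h : A.IsFlip t t' i j k)
    (hf : A.IsMono f) : f (t j) i < f (t i) i := by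
  refine hf _ _ (h.left.isEdge h.ij.symm) i (h.left.lt i j h.ij.symm) ?_
  rw [← h.eq_left]
  exact h.right.not_null i

theorem IsTriple.eq_of_forall_exists {t s : Fin 3 → V} (ht : A.IsTriple t) (hs : A.IsTriple s)
    (h : ∀ m, ∃ n, t m = s n) : t = s := by
  choose σ hσ using h
  have hinj : Function.Injective σ := fun a b hab =>
    ht.injective (by rw [hσ a, hσ b, hab])
  funext i
  obtain ⟨m, rfl⟩ := Finite.injective_iff_surjective.1 hinj i
  refine A.inj (σ m) _ _ (le_antisymm ?_ ?_)
  · rw [hσ (σ m)]; exact hs.le _ _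
  · rw [← hσ m]; exact ht.le _ _

theorem Hex.combo {p : V} {X Y Z : Fin 3 → ℝ} (hX : A.Hex f p X) (hY : A.Hex f p Y) {a b : ℝ}
    (ha : 0 ≤ a) (hb : 0 ≤ b) (hab : a + b = 1) (hZ : ∀ i, Z i = a * X i + b * Y i) :
    A.Hex f p Z := by
  have e : ∀ c : ℝ, c = a * c + b * c := fun c => by rw [← add_mul, hab, one_mul]
  refine ⟨fun i hi => ?_, fun i w hw => ?_⟩
  · rw [hZ, e (f p i)]
    exact add_le_add (mul_le_mul_of_nonneg_left (hX.1 i hi) ha)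
      (mul_le_mul_of_nonneg_left (hY.1 i hi) hb)
  · rw [hZ, e (f w i)]
    exact add_le_add (mul_le_mul_of_nonneg_left (hX.2 i w hw) ha)
      (mul_le_mul_of_nonneg_left (hY.2 i w hw) hb)

variable [Finite V]

/-- A minimal pair of two axis points lies in exactly one triple. -/
theorem IsEdge.exists_ray {p q : V} (h : A.IsEdge p q) (hp : A.IsAxisPoint p)
    (hq : A.IsAxisPoint q) :
    ∃ t, ∃ i j k : Fin 3, A.IsTriple t ∧ i ≠ j ∧ i ≠ k ∧ j ≠ k ∧ t i = A.a i ∧ t k = A.a k ∧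
      A.g (t k) j < A.g (t i) j ∧ ((t i = p ∧ t k = q) ∨ (t i = q ∧ t k = p)) ∧
      ∀ t', A.IsTriple t' → (∃ m, p = t' m) → (∃ m, q = t' m) → t' = t := by
  -- `p` is on one of the two axes in the directions where it is higher than `q`
  have main : ∀ {p q : V}, A.IsEdge p q → A.IsAxisPoint q → ∀ {i j k : Fin 3}, i ≠ j → i ≠ k →
      j ≠ k → A.g q i < A.g p i → A.g q j < A.g p j → A.g p k < A.g q k → p = A.a i →
      ∃ t, A.IsTriple t ∧ t i = A.a i ∧ t k = A.a k ∧ A.g (t k) j < A.g (t i) j ∧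
        (t i = p ∧ t k = q) ∧
        ∀ t', A.IsTriple t' → (∃ m, p = t' m) → (∃ m, q = t' m) → t' = t := by
    intro p q h hq i j k hij hik hjk hi hj hk hp
    obtain ⟨m, rfl⟩ := hq
    have hmi : m ≠ i := by rintro rfl; exact absurd hi (not_lt.2 (A.top _ _))
    have hmj : m ≠ j := by rintro rfl; exact absurd hj (not_lt.2 (A.top _ _))
    obtain rfl : m = k := by omega
    subst hp
    obtain ⟨t, ht, e1, e2⟩ := h.exists_triple hij.symm hjk hik hj hi hk
      ⟨A.a j, A.lt_top (A.a_ne hij.symm), A.lt_top (A.a_ne hjk)⟩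
    refine ⟨t, ht, e1, e2, by rwa [e1, e2], ⟨e1, e2⟩, fun t' ht' h1 h2 => ?_⟩
    obtain ⟨e3, e4⟩ := ht'.exists_eq_of_lt hij hik hjk hi hj h1 h2
    have e5 := e4.resolve_right fun e => ht'.not_null j ⟨i, hij, e⟩
    exact ht'.eq_of_eq ht hij.symm hjk hik (e5.trans e1.symm) (e3.trans e2.symm)
  have main' : ∀ {p q : V}, A.IsEdge p q → A.IsAxisPoint p → A.IsAxisPoint q →
      ∀ {i j k : Fin 3}, i ≠ j → i ≠ k → j ≠ k → A.g q i < A.g p i → A.g q j < A.g p j →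
      A.g p k < A.g q k → ∃ t, ∃ i j k : Fin 3, A.IsTriple t ∧ i ≠ j ∧ i ≠ k ∧ j ≠ k ∧
        t i = A.a i ∧ t k = A.a k ∧ A.g (t k) j < A.g (t i) j ∧ (t i = p ∧ t k = q) ∧
        ∀ t', A.IsTriple t' → (∃ m, p = t' m) → (∃ m, q = t' m) → t' = t := by
    intro p q h hp hq i j k hij hik hjk hi hj hk
    obtain ⟨m, hm⟩ := hp
    have hmk : m ≠ k := by rintro rfl; rw [hm] at hk; exact absurd hk (not_lt.2 (A.top _ _))
    rcases fin_three_cases hij hik hjk m with rfl | rfl | rfl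
    · obtain ⟨t, h1, h2, h3, h4, h5, h6⟩ := main h hq hij hik hjk hi hj hk hm
      exact ⟨t, _, _, _, h1, hij, hik, hjk, h2, h3, h4, h5, h6⟩
    · obtain ⟨t, h1, h2, h3, h4, h5, h6⟩ := main h hq hij.symm hjk hik hj hi hk hm
      exact ⟨t, _, _, _, h1, hij.symm, hjk, hik, h2, h3, h4, h5, h6⟩
    · exact absurd rfl hmk
  obtain ⟨i, j, k, hij, hik, hjk, ⟨hi, hj, hk⟩ | ⟨hi, hj, hk⟩⟩ := h.exists_orientation
  · obtain ⟨t, i, j, k, h1, h2, h3, h4, h5, h6, h7, h8, h9⟩ :=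
      main' h hp hq hij hik hjk hi hj hk
    exact ⟨t, i, j, k, h1, h2, h3, h4, h5, h6, h7, Or.inl h8, h9⟩
  · obtain ⟨t, i, j, k, h1, h2, h3, h4, h5, h6, h7, h8, h9⟩ :=
      main' h.symm hq hp hij hik hjk hi hj hk
    exact ⟨t, i, j, k, h1, h2, h3, h4, h5, h6, h7, Or.inr h8, fun t' a b c => h9 t' a c b⟩

/-- A minimal pair of points that are not both axis points lies in two triples. -/
theorem IsEdge.exists_flip {p q : V} (h : A.IsEdge p q)
    (hpq : ¬ (A.IsAxisPoint p ∧ A.IsAxisPoint q)) :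
    ∃ t t', ∃ i j k : Fin 3, A.IsFlip t t' i j k ∧
      ((t j = p ∧ t k = q) ∨ (t j = q ∧ t k = p)) := by
  have main : ∀ {p q : V}, A.IsEdge p q → ¬ (A.IsAxisPoint p ∧ A.IsAxisPoint q) →
      ∀ {i j k : Fin 3}, i ≠ j → i ≠ k → j ≠ k → A.g q i < A.g p i → A.g q j < A.g p j →
      A.g p k < A.g q k → ∃ t t', A.IsFlip t t' i j k ∧ t j = p ∧ t k = q := by
    intro p q h hpq i j k hij hik hjk hi hj hk
    -- if `p` were an axis point, say on axis `i`, then `q` would be lower than an axis point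
    -- in its null coordinate `j`
    have hp : ¬ A.IsAxisPoint p := by
      rintro ⟨m, rfl⟩
      refine hpq ⟨⟨m, rfl⟩, ?_⟩
      by_contra hq
      have hlow := A.low q (fun l hl => hq ⟨l, hl⟩) m
      by_cases hmi : m = i
      · exact lt_asymm hj (hlow j (hmi ▸ hij))
      · exact lt_asymm hi (hlow i hmi)
    have hpn : ∀ l, ¬ A.Null p l := fun l ⟨m, _, e⟩ => hp ⟨m, e⟩
    have hqn : ¬ A.Null q k := A.not_null_of_lt (hpn k) hk.le
    obtain ⟨t, ht, e1, e2⟩ := h.exists_triple hij hik hjk hi hj hk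
      ⟨A.a i, A.low_of_not_null hij (hpn j), A.low_of_not_null hik hqn⟩
    obtain ⟨t', ht', e1', e2'⟩ := h.exists_triple hij.symm hjk hik hj hi hk
      ⟨A.a j, A.low_of_not_null hij.symm (hpn i), A.low_of_not_null hjk hqn⟩
    exact ⟨t, t', ⟨ht, ht', hij, hik, hjk, e1'.trans e1.symm, e2'.trans e2.symm⟩, e1, e2⟩
  obtain ⟨i, j, k, hij, hik, hjk, ⟨hi, hj, hk⟩ | ⟨hi, hj, hk⟩⟩ := h.exists_orientation
  · obtain ⟨t, t', h1, h2⟩ := main h hpq hij hik hjk hi hj hk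
    exact ⟨t, t', i, j, k, h1, Or.inl h2⟩
  · obtain ⟨t, t', h1, h2⟩ := main h.symm (fun h => hpq h.symm) hij hik hjk hi hj hk
    exact ⟨t, t', i, j, k, h1, Or.inr h2⟩

/-- At a triple, dropping the point labelled `m` leads to another triple, or the remaining two
points are axis points. -/
theorem IsTriple.exists_flip {t : Fin 3 → V} (ht : A.IsTriple t) {m n l : Fin 3} (hmn : m ≠ n)
    (hml : m ≠ l) (hnl : n ≠ l) (h : ¬ (A.IsAxisPoint (t n) ∧ A.IsAxisPoint (t l))) :
    ∃ t' j k, A.IsFlip t t' m j k := by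
  -- the label `i` of the dropped point can be read off from the two remaining points
  have hlab : ∀ {i j k : Fin 3}, i ≠ j → i ≠ k → j ≠ k →
      ((t j = t n ∧ t k = t l) ∨ (t j = t l ∧ t k = t n)) → i = m := by
    intro i j k hij hik hjk h
    rcases h with ⟨h1, h2⟩ | ⟨h1, h2⟩ <;>
    · have := ht.injective h1
      have := ht.injective h2
      omega
  obtain ⟨s, s', i, j, k, hs, hjk⟩ := (ht.isEdge hnl).exists_flip h
  have hmem : (∃ m, s j = t m) ∧ ∃ m, s k = t m := by
    rcases hjk with ⟨h1, h2⟩ | ⟨h1, h2⟩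
    exacts [⟨⟨n, h1⟩, l, h2⟩, ⟨⟨l, h1⟩, n, h2⟩]
  rcases hs.eq_or_eq ht hmem.1 hmem.2 with rfl | rfl
  · obtain rfl := hlab hs.ij hs.ik hs.jk hjk
    exact ⟨_, _, _, hs⟩
  · rw [← hs.eq_left, ← hs.eq_right] at hjk
    obtain rfl := hlab hs.ij.symm hs.jk hs.ik hjk
    exact ⟨_, _, _, hs.symm⟩

end GenericAntichain

end MinkowskiVoronoi

/-! ### The Euclidean plane -/

namespace MinkowskiVoronoi

/-- The parallel projection of the plane where the coordinates add up to `0` to the Euclidean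
plane, which takes the differences of basis vectors to the six directions. -/
noncomputable def embed (X : Fin 3 → ℝ) : Plane := !₂[X 1 + X 2 / 2, X 2 * (√3 / 2)]

/-- The inverse of `embed` on the plane where the coordinates add up to `0`. -/
noncomputable def coord (P : Plane) : Fin 3 → ℝ :=
  ![-(P 0) - P 1 / √3, P 0 - P 1 / √3, 2 * P 1 / √3]

theorem coord_embed {X : Fin 3 → ℝ} (h : X 0 + X 1 + X 2 = 0) : coord (embed X) = X := by
  have h3 : (√3 : ℝ) ≠ 0 := by positivity
  ext i
  fin_cases i
  · simp [coord, embed]; field_simp; linarith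
  · simp [coord, embed]; field_simp; linarith
  · simp [coord, embed]; field_simp

theorem coord_combo (a b : ℝ) (P Q : Plane) (i : Fin 3) :
    coord (a • P + b • Q) i = a * coord P i + b * coord Q i := by
  fin_cases i <;> simp [coord] <;> ring

theorem embed_sub (X Y : Fin 3 → ℝ) : embed X - embed Y = embed (X - Y) := by
  ext i
  fin_cases i <;> simp [embed] <;> ring

theorem embed_smul (t : ℝ) (X : Fin 3 → ℝ) : embed (t • X) = t • embed X := by
  ext i
  fin_cases i <;> simp [embed] <;> ring

theorem direction_eq (k : Fin 6) :
    direction k = embed (Pi.single (incCoord k) 1 - Pi.single (decCoord k) 1) := by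
  have e2 : (2 : ℝ) * (Real.pi / 3) = Real.pi - Real.pi / 3 := by ring
  have e3 : (3 : ℝ) * (Real.pi / 3) = Real.pi := by ring
  have e4 : (4 : ℝ) * (Real.pi / 3) = Real.pi / 3 + Real.pi := by ring
  have e5 : (5 : ℝ) * (Real.pi / 3) = 2 * Real.pi - Real.pi / 3 := by ring
  ext i
  fin_cases k <;> fin_cases i <;>
    simp [direction, embed, incCoord, decCoord, e2, e3, e4, e5,
      Real.cos_pi_sub, Real.sin_pi_sub, Real.cos_add_pi, Real.sin_add_pi, Real.cos_two_pi_sub,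
      Real.sin_two_pi_sub] <;> norm_num

theorem exists_label {i j k : Fin 3} (hij : i ≠ j) (hik : i ≠ k) (hjk : j ≠ k) :
    ∃ l : Fin 6, incCoord l = j ∧ decCoord l = i ∧ fixCoord l = k := by
  revert i j k; decide

end MinkowskiVoronoi

/-! ### Relative minima as a generic antichain -/

namespace MinkowskiVoronoi

/-- The coordinates of a point in general position, with ties at `0` broken: a null coordinate of
a point on axis `j` is replaced by `j - 3`. -/
noncomputable def perturb (p : Fin 3 → ℝ) (i : Fin 3) : ℝ :=
  if p i = 0 then ∑ j : Fin 3, if p j = 0 then 0 else ((j : ℕ) : ℝ) - 3 else p i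

theorem perturb_of_ne {p : Fin 3 → ℝ} {i : Fin 3} (h : p i ≠ 0) : perturb p i = p i := if_neg h

theorem perturb_nonpos {p : Fin 3 → ℝ} {i : Fin 3} (h : p i = 0) : perturb p i ≤ 0 := by
  rw [perturb, if_pos h]
  refine Finset.sum_nonpos fun j _ => ?_
  split_ifs
  · exact le_rfl
  · have : ((j : ℕ) : ℝ) ≤ 2 := by exact_mod_cast (by omega : (j : ℕ) ≤ 2)
    linarith

theorem perturb_of_onAxis {p : Fin 3 → ℝ} {i j : Fin 3} (h : OnAxis j p) (hj : p j ≠ 0)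
    (hij : i ≠ j) : perturb p i = ((j : ℕ) : ℝ) - 3 := by
  rw [perturb, if_pos (h i hij), Finset.sum_eq_single j]
  · rw [if_neg hj]
  · intro l _ hl
    rw [if_pos (h l hl)]
  · intro hn; exact absurd (Finset.mem_univ _) hn

theorem perturb_lt {p q : Fin 3 → ℝ} {i : Fin 3} (hp : 0 ≤ p i) (h : p i < q i) :
    perturb p i < perturb q i := by
  have hq : q i ≠ 0 := (hp.trans_lt h).ne'
  rw [perturb_of_ne hq]
  by_cases h0 : p i = 0
  · exact (perturb_nonpos h0).trans_lt (h0 ▸ h)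
  · rwa [perturb_of_ne h0]

theorem le_of_perturb_le {p q : Fin 3 → ℝ} {i : Fin 3} (hq : 0 ≤ q i)
    (h : perturb p i ≤ perturb q i) : p i ≤ q i := by
  by_contra! hlt
  exact absurd (perturb_lt hq hlt) (not_lt.2 h)

theorem lt_of_perturb_lt {p q : Fin 3 → ℝ} {i : Fin 3} (hq : 0 ≤ q i) (hq0 : q i ≠ 0)
    (h : perturb p i < perturb q i) : p i < q i := by
  rw [perturb_of_ne hq0] at h
  by_cases h0 : p i = 0
  · rw [h0]; exact lt_of_le_of_ne hq hq0.symm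
  · rwa [perturb_of_ne h0] at h

theorem perturb_le {p q : Fin 3 → ℝ} {i : Fin 3} (hp : 0 ≤ p i) (hq : q i ≠ 0)
    (h : p i ≤ q i) : perturb p i ≤ perturb q i := by
  rcases h.lt_or_eq with h | h
  · exact (perturb_lt hp h).le
  · rw [perturb_of_ne hq, perturb_of_ne (h ▸ hq), h]

section Position

variable {S : Set (Fin 3 → ℝ)}

theorem exists_axis_points (hax : IsAxial S) (hgen : InGeneralPosition S) :
    ∃ b : Fin 3 → Fin 3 → ℝ, (∀ i, b i ∈ S ∧ OnAxis i (b i) ∧ 0 < b i i) ∧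
      ∀ x ∈ S, ∀ i, x i = 0 → ∃ j, j ≠ i ∧ x = b j := by
  choose b hbS hbA using hax.2
  have hpos : ∀ i, 0 < b i i := by
    intro i
    refine lt_of_le_of_ne (hax.1 _ (hbS i) i) fun h0 => ?_
    refine ((hgen.1 i).2.1 (b i) (hbS i) h0.symm).1 (funext fun j => ?_)
    by_cases hj : j = i
    · subst hj; exact h0.symm
    · exact hbA i j hj
  refine ⟨b, fun i => ⟨hbS i, hbA i, hpos i⟩, fun x hx i hxi => ?_⟩
  obtain ⟨j, k, hjk, hji, hki⟩ := GenericAntichain.exists_two_ne i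
  have hne : b j ≠ b k := fun e => by
    have := hpos j
    rw [e, hbA k j hjk] at this
    exact lt_irrefl _ this
  have hcard := (hgen.1 i).1
  have hsub : ({b j, b k} : Set (Fin 3 → ℝ)) ⊆ {x ∈ S | x i = 0} := by
    rintro y (rfl | rfl)
    · exact ⟨hbS j, hbA j i hji.symm⟩
    · exact ⟨hbS k, hbA k i hki.symm⟩
  have heq := Set.eq_of_subset_of_ncard_le hsub (by rw [hcard, Set.ncard_pair hne])
    (Set.finite_of_ncard_ne_zero (by rw [hcard]; norm_num))
  have hmem : x ∈ ({b j, b k} : Set (Fin 3 → ℝ)) := heq ▸ ⟨hx, hxi⟩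
  rcases hmem with rfl | rfl
  exacts [⟨j, hji, rfl⟩, ⟨k, hki, rfl⟩]

theorem maxCoord_singleton {n : ℕ} (p : Fin n → ℝ) (i : Fin n) : maxCoord {p} i = p i := by
  simp [maxCoord]

theorem eq_of_mem_vrm {x p : Fin 3 → ℝ} (hnn : ∀ x ∈ S, ∀ i, 0 ≤ x i) (hp : p ∈ vrm S)
    (hx : x ∈ S) (hle : ∀ i, x i ≤ p i) : x = p := by
  by_contra hne
  exact hp.2 x hx hne fun i => ⟨hnn x hx i, by rw [maxCoord_singleton]; exact hle i⟩

/-- The relative minima of an axial set in general position form a generic antichain. -/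
theorem exists_genericAntichain (hax : IsAxial S) (hgen : InGeneralPosition S) :
    ∃ A : GenericAntichain (vrm S), (∀ p i, A.g p i = perturb p.1 i) ∧
      ∀ p i, A.Null p i ↔ p.1 i = 0 := by
  obtain ⟨b, hb, hzero⟩ := exists_axis_points hax hgen
  have hnn := hax.1
  have hbne : ∀ {i j}, b i = b j → i = j := fun {i j} e => by
    by_contra hij
    have := (hb i).2.2
    rw [e, (hb j).2.1 i hij] at this
    exact lt_irrefl _ this
  have hbV : ∀ i, b i ∈ vrm S := fun i => by
    refine ⟨(hb i).1, fun x hx hne hbox => hne ?_⟩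
    have hx0 : ∀ j, j ≠ i → x j = 0 := fun j hj => by
      have := hbox j
      rw [maxCoord_singleton, (hb i).2.1 j hj] at this
      exact le_antisymm this.2 this.1
    obtain ⟨j, k, hjk, hji, hki⟩ := GenericAntichain.exists_two_ne i
    obtain ⟨l, hl, rfl⟩ := hzero x hx j (hx0 j hji)
    obtain ⟨m, hm, e⟩ := hzero _ hx k (hx0 k hki)
    have := hbne e
    obtain rfl : l = i := by omega
    rfl
  have hpert : ∀ {i j}, i ≠ j → perturb (b j) i = ((j : ℕ) : ℝ) - 3 := fun {i j} hij =>
    perturb_of_onAxis (hb j).2.1 (hb j).2.2.ne' hij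
  have hcast : ∀ {i j : Fin 3}, i < j → ((i : ℕ) : ℝ) < ((j : ℕ) : ℝ) := fun {i j} h => by
    exact_mod_cast h
  let A : GenericAntichain (vrm S) :=
    { g := fun p i => perturb p.1 i
      inj := by
        rintro i ⟨p, hp⟩ ⟨q, hq⟩ h
        refine Subtype.ext ?_
        have hpq : p i = q i := le_antisymm (le_of_perturb_le (hnn q hq.1 i) h.le)
          (le_of_perturb_le (hnn p hp.1 i) h.ge)
        show p = q
        by_cases h0 : p i = 0
        · obtain ⟨j, hj, rfl⟩ := hzero p hp.1 i h0
          obtain ⟨k, hk, rfl⟩ := hzero q hq.1 i (hpq ▸ h0)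
          have h' : perturb (b j) i = perturb (b k) i := h
          rw [hpert hj.symm, hpert hk.symm] at h'
          rcases lt_trichotomy j k with hjk | rfl | hjk
          · linarith [hcast hjk]
          · rfl
          · linarith [hcast hjk]
        · exact (hgen.2 i (p i) h0) ⟨hp.1, rfl⟩ ⟨hq.1, hpq.symm⟩
      anti := fun p q h => Subtype.ext (eq_of_mem_vrm hnn q.2 p.2.1 fun i =>
        le_of_perturb_le (hnn q.1 q.2.1 i) (h i))
      a := fun i => ⟨b i, hbV i⟩
      top := fun i p => by
        refine perturb_le (hnn p.1 p.2.1 i) (hb i).2.2.ne' ?_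
        by_contra! hlt
        have e : b i = p.1 := eq_of_mem_vrm hnn p.2 (hb i).1 fun j => by
          by_cases hj : j = i
          · subst hj; exact hlt.le
          · rw [(hb i).2.1 j hj]; exact hnn p.1 p.2.1 j
        exact lt_irrefl _ (hlt.trans_eq (congrFun e i).symm)
      low := fun p hp i j hij => by
        refine perturb_lt (hnn _ (hb i).1 j) ?_
        show b i j < p.1 j
        rw [(hb i).2.1 j hij.symm]
        refine lt_of_le_of_ne (hnn p.1 p.2.1 j) fun h0 => ?_
        obtain ⟨k, -, e⟩ := hzero p.1 p.2.1 j h0.symm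
        exact hp k (Subtype.ext e)
      low_axis := fun i j k hij hkj hik => by
        show perturb (b i) j < perturb (b k) j
        rw [hpert hij.symm, hpert hkj.symm]
        linarith [hcast hik] }
  refine ⟨A, fun p i => rfl, fun p i => ⟨?_, fun h0 => ?_⟩⟩
  · rintro ⟨j, hj, rfl⟩
    exact (hb j).2.1 i hj.symm
  · obtain ⟨j, hj, e⟩ := hzero p.1 p.2.1 i h0
    exact ⟨j, hj, Subtype.ext e⟩

end Position

end MinkowskiVoronoi

/-! ### Minimal sets as triples and edges -/

namespace MinkowskiVoronoi

section MaxCoord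

variable {n : ℕ} {F : Finset (Fin n → ℝ)} {i : Fin n}

theorem le_maxCoord {p : Fin n → ℝ} (hp : p ∈ F) : p i ≤ maxCoord F i :=
  le_csSup (F.finite_toSet.image _).bddAbove ⟨p, hp, rfl⟩

theorem maxCoord_eq {p : Fin n → ℝ} (hp : p ∈ F) (h : ∀ x ∈ F, x i ≤ p i) :
    maxCoord F i = p i := by
  refine le_antisymm (csSup_le ⟨p i, p, hp, rfl⟩ ?_) (le_maxCoord hp)
  rintro _ ⟨x, hx, rfl⟩
  exact h x hx

theorem maxCoord_lt {c : ℝ} (hc : 0 < c) (h : ∀ x ∈ F, x i < c) : maxCoord F i < c := by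
  rcases F.eq_empty_or_nonempty with rfl | hne
  · simpa [maxCoord] using hc
  · obtain ⟨p, hp, hmax⟩ := F.exists_max_image (fun x => x i) hne
    rw [maxCoord_eq hp hmax]
    exact h p hp

/-- Sets span different boxes if one of them lies strictly below some point of the other in one
coordinate. The empty set, whose sizes are the junk value `0`, is covered since `0 < p i`. -/
theorem box_ne_box {G : Finset (Fin n → ℝ)} {p : Fin n → ℝ} (hp : p ∈ F) (hpos : ∀ j, 0 ≤ p j)
    (hi : 0 < p i) (h : ∀ x ∈ G, x i < p i) : box G ≠ box F := by
  intro e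
  have hmem : p ∈ box F := fun j => ⟨hpos j, le_maxCoord hp⟩
  rw [← e] at hmem
  exact absurd (hmem i).2 (not_le.2 (maxCoord_lt hi h))

end MaxCoord

variable {S : Set (Fin 3 → ℝ)} {A : GenericAntichain (vrm S)}

/-- The points of a minimal set are those where the sizes of its box are attained. -/
theorem IsMinimalSubset.exists_top (hnn : ∀ x ∈ S, ∀ i, 0 ≤ x i)
    (hg : ∀ p i, A.g p i = perturb p.1 i) {F : Finset (Fin 3 → ℝ)} (hF : IsMinimalSubset S F)
    (hne : F.Nonempty) :
    ∃ t : Fin 3 → vrm S, (∀ x, x ∈ F ↔ ∃ m, x = (t m).1) ∧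
      (∀ i (p : vrm S), p.1 ∈ F → A.g p i ≤ A.g (t i) i) ∧
      ∀ q : vrm S, (∀ i, A.g q i ≤ A.g (t i) i) → q.1 ∈ F := by
  classical
  have htop : ∀ i : Fin 3, ∃ p : vrm S, p.1 ∈ F ∧ ∀ q : vrm S, q.1 ∈ F → A.g q i ≤ A.g p i := by
    intro i
    obtain ⟨p, hp, hmax⟩ := F.exists_max_image (fun x => perturb x i) hne
    refine ⟨⟨p, hF.1 hp⟩, hp, fun q hq => ?_⟩
    rw [hg, hg]
    exact hmax q.1 hq
  choose t htF ht using htop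
  have hmax : ∀ i, ∀ x ∈ F, x i ≤ (t i).1 i := fun i x hx => by
    have := ht i ⟨x, hF.1 hx⟩ hx
    rw [hg, hg] at this
    exact le_of_perturb_le (hnn _ (t i).2.1 i) this
  have hsub : Finset.univ.image (fun m => (t m).1) ⊆ F := by
    intro x hx
    obtain ⟨m, -, rfl⟩ := Finset.mem_image.1 hx
    exact htF m
  have heq : Finset.univ.image (fun m => (t m).1) = F := by
    by_contra hne'
    refine hF.2.2 _ (lt_of_le_of_ne hsub hne') ?_
    have : ∀ i, maxCoord (Finset.univ.image fun m => (t m).1) i = maxCoord F i := fun i => by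
      rw [maxCoord_eq (htF i) (hmax i)]
      exact maxCoord_eq (Finset.mem_image_of_mem (fun m => (t m).1) (Finset.mem_univ i))
        fun x hx => hmax i x (hsub hx)
    simp only [box, this]
  refine ⟨t, fun x => ?_, ht, fun q hq => ?_⟩
  · rw [← heq, Finset.mem_image]
    exact ⟨fun ⟨m, _, e⟩ => ⟨m, e.symm⟩, fun ⟨m, e⟩ => ⟨m, Finset.mem_univ _, e.symm⟩⟩
  · by_contra hq'
    refine hF.2.1 q.1 q.2 hq' fun i => ⟨hnn _ q.2.1 i, ?_⟩
    have := hq i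
    rw [hg, hg] at this
    exact (le_of_perturb_le (hnn _ (t i).2.1 i) this).trans (le_maxCoord (htF i))

theorem Vertex.exists_isTriple (hnn : ∀ x ∈ S, ∀ i, 0 ≤ x i)
    (hg : ∀ p i, A.g p i = perturb p.1 i) (v : Vertex S) :
    ∃ t : Fin 3 → vrm S, A.IsTriple t ∧ ∀ x, x ∈ v.1 ↔ ∃ m, x = (t m).1 := by
  classical
  obtain ⟨F, hF, hcard⟩ := v
  have hcard : F.card = 3 := hcard
  obtain ⟨t, h1, h2, h3⟩ := hF.exists_top hnn hg (Finset.card_pos.1 (by omega))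
  have himage : Finset.univ.image (fun m => (t m).1) = F := by
    ext x
    rw [h1, Finset.mem_image]
    exact ⟨fun ⟨m, _, e⟩ => ⟨m, e.symm⟩, fun ⟨m, e⟩ => ⟨m, Finset.mem_univ _, e.symm⟩⟩
  have hinj : Function.Injective fun m => (t m).1 := by
    have := Finset.card_image_iff.1 (show (Finset.univ.image fun m => (t m).1).card =
      (Finset.univ : Finset (Fin 3)).card by rw [himage, hcard]; rfl)
    rwa [Finset.coe_univ, Set.injOn_univ] at this
  refine ⟨t, ⟨fun i j hij => ?_, fun q hq => ?_⟩, h1⟩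
  · exact A.lt_of_le (fun e => hij (hinj (congrArg Subtype.val e))) (h2 i _ ((h1 _).2 ⟨j, rfl⟩))
  · obtain ⟨m, hm⟩ := (h1 _).1 (h3 q hq)
    exact ⟨m, Subtype.ext hm⟩

theorem exists_vertex_of_isTriple (hnn : ∀ x ∈ S, ∀ i, 0 ≤ x i)
    (hg : ∀ p i, A.g p i = perturb p.1 i) (hnull : ∀ p i, A.Null p i ↔ p.1 i = 0)
    {t : Fin 3 → vrm S} (ht : A.IsTriple t) :
    ∃ v : Vertex S, ∀ x, x ∈ v.1 ↔ ∃ m, x = (t m).1 := by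
  classical
  have hmem : ∀ x, x ∈ Finset.univ.image (fun m => (t m).1) ↔ ∃ m, x = (t m).1 := fun x => by
    rw [Finset.mem_image]
    exact ⟨fun ⟨m, _, e⟩ => ⟨m, e.symm⟩, fun ⟨m, e⟩ => ⟨m, Finset.mem_univ _, e.symm⟩⟩
  have hne0 : ∀ i, (t i).1 i ≠ 0 := fun i h => ht.not_null i ((hnull _ _).2 h)
  have hlt : ∀ i m, m ≠ i → (t m).1 i < (t i).1 i := fun i m hm =>
    lt_of_perturb_lt (hnn _ (t i).2.1 i) (hne0 i) (by rw [← hg, ← hg]; exact ht.lt i m hm)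
  have hle : ∀ i m, (t m).1 i ≤ (t i).1 i := fun i m => by
    by_cases hm : m = i
    · rw [hm]
    · exact (hlt i m hm).le
  refine ⟨⟨Finset.univ.image fun m => (t m).1, ⟨?_, ?_, ?_⟩, ?_⟩, hmem⟩
  · intro x hx
    obtain ⟨m, rfl⟩ := (hmem x).1 hx
    exact (t m).2
  · intro x hx hxF hbox
    obtain ⟨m, hm⟩ := ht.mem ⟨x, hx⟩ fun i => by
      have h1 := (hbox i).2
      rw [maxCoord_eq ((hmem _).2 ⟨i, rfl⟩) (fun y hy => by
        obtain ⟨m, rfl⟩ := (hmem y).1 hy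
        exact hle i m)] at h1
      rw [hg, hg]
      exact perturb_le (hbox i).1 (hne0 i) h1
    exact hxF ((hmem x).2 ⟨m, congrArg Subtype.val hm⟩)
  · intro G hG
    obtain ⟨y, hy, hyG⟩ := Finset.exists_of_ssubset hG
    obtain ⟨i, rfl⟩ := (hmem y).1 hy
    refine box_ne_box hy (hnn _ (t i).2.1) (lt_of_le_of_ne (hnn _ (t i).2.1 i) (hne0 i).symm)
      fun x hx => ?_
    obtain ⟨m, rfl⟩ := (hmem x).1 (hG.1 hx)
    exact hlt i m fun e => hyG (e ▸ hx)
  · rw [Finset.card_image_of_injective _ fun m n e => ht.injective (Subtype.ext e)]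
    rfl

theorem Edge.exists_isEdge (hnn : ∀ x ∈ S, ∀ i, 0 ≤ x i)
    (hg : ∀ p i, A.g p i = perturb p.1 i) (e : Edge S) :
    ∃ p q : vrm S, A.IsEdge p q ∧ ∀ x, x ∈ e.1 ↔ x = p.1 ∨ x = q.1 := by
  classical
  obtain ⟨F, hF, hcard⟩ := e
  have hcard : F.card = 2 := hcard
  obtain ⟨t, h1, h2, h3⟩ := hF.exists_top hnn hg (Finset.card_pos.1 (by omega))
  obtain ⟨p, q, hpq, rfl⟩ := Finset.card_eq_two.1 hcard
  have hmem : ∀ x, x ∈ ({p, q} : Finset (Fin 3 → ℝ)) ↔ x = p ∨ x = q := fun x => by simp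
  refine ⟨⟨p, hF.1 ((hmem p).2 (Or.inl rfl))⟩, ⟨q, hF.1 ((hmem q).2 (Or.inr rfl))⟩,
    ⟨fun e => hpq (congrArg Subtype.val e), fun u hu => ?_⟩, hmem⟩
  rcases (hmem _).1 (h3 u fun i => (hu i).trans (max_le
    (h2 i _ ((hmem p).2 (Or.inl rfl))) (h2 i _ ((hmem q).2 (Or.inr rfl))))) with e | e
  exacts [Or.inl (Subtype.ext e), Or.inr (Subtype.ext e)]

theorem exists_edge_of_isEdge (hnn : ∀ x ∈ S, ∀ i, 0 ≤ x i)
    (hg : ∀ p i, A.g p i = perturb p.1 i) (hnull : ∀ p i, A.Null p i ↔ p.1 i = 0)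
    {p q : vrm S} (h : A.IsEdge p q) : ∃ e : Edge S, ∀ x, x ∈ e.1 ↔ x = p.1 ∨ x = q.1 := by
  classical
  have hmem : ∀ x, x ∈ ({p.1, q.1} : Finset (Fin 3 → ℝ)) ↔ x = p.1 ∨ x = q.1 := fun x => by simp
  refine ⟨⟨{p.1, q.1}, ⟨?_, ?_, ?_⟩, ?_⟩, hmem⟩
  · intro x hx
    rcases (hmem x).1 hx with rfl | rfl
    exacts [p.2, q.2]
  · intro x hx hxF hbox
    have hxp : x ≠ p.1 := fun e => hxF ((hmem x).2 (Or.inl e))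
    have hxq : x ≠ q.1 := fun e => hxF ((hmem x).2 (Or.inr e))
    rcases h.mem ⟨x, hx⟩ fun i => by
      have h1 : x i ≤ max (p.1 i) (q.1 i) := (hbox i).2.trans (csSup_le ⟨_, p.1, by simp, rfl⟩ (by
        rintro _ ⟨y, hy, rfl⟩
        rcases (hmem y).1 hy with rfl | rfl
        exacts [le_max_left _ _, le_max_right _ _]))
      rw [hg, hg, hg]
      -- at most two of the three points lie on a coordinate plane
      by_cases hp0 : p.1 i = 0
      · by_cases hq0 : q.1 i = 0
        · rw [hp0, hq0, max_self] at h1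
          have hx0 : x i = 0 := le_antisymm h1 (hbox i).1
          obtain ⟨j, hj, e1⟩ := (hnull p i).2 hp0
          obtain ⟨k, hk, e2⟩ := (hnull q i).2 hq0
          obtain ⟨l, hl, e3⟩ := (hnull ⟨x, hx⟩ i).2 hx0
          have hjk : j ≠ k := by rintro rfl; exact h.ne (e1.trans e2.symm)
          have hjl : j ≠ l := by rintro rfl; exact hxp (congrArg Subtype.val (e3.trans e1.symm))
          have hkl : k ≠ l := by rintro rfl; exact hxq (congrArg Subtype.val (e3.trans e2.symm))
          omega
        · rw [max_eq_right (by rw [hp0]; exact hnn _ q.2.1 i)] at h1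
          exact (perturb_le (hbox i).1 hq0 h1).trans (le_max_right _ _)
      · rcases le_max_iff.1 h1 with h2 | h2
        · exact (perturb_le (hbox i).1 hp0 h2).trans (le_max_left _ _)
        · by_cases hq0 : q.1 i = 0
          · exact (perturb_le (hbox i).1 hp0 (h2.trans (by
              rw [hq0]; exact hnn _ p.2.1 i))).trans (le_max_left _ _)
          · exact (perturb_le (hbox i).1 hq0 h2).trans (le_max_right _ _) with e | e
    · exact hxp (congrArg Subtype.val e)
    · exact hxq (congrArg Subtype.val e)
  · intro G hG
    -- a missing point is not below the other one, by incomparability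
    have key : ∀ {F : Finset (Fin 3 → ℝ)} {p q : vrm S}, p ≠ q → p.1 ∈ F → (∀ x ∈ G, x = q.1) →
        box G ≠ box F := by
      intro F p q hpq hpF hG'
      obtain ⟨i, hi⟩ : ∃ i, q.1 i < p.1 i := by
        by_contra! hle
        exact hpq (Subtype.ext (eq_of_mem_vrm hnn q.2 p.2.1 hle))
      refine box_ne_box (i := i) hpF (hnn _ p.2.1) ((hnn _ q.2.1 i).trans_lt hi) fun x hx => ?_
      rw [hG' x hx]; exact hi
    have hsub := hG.1
    by_cases hpG : p.1 ∈ G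
    · have hqG : q.1 ∉ G := fun hqG => hG.2 fun x hx => by
        rcases (hmem x).1 hx with rfl | rfl <;> assumption
      exact key h.ne.symm ((hmem _).2 (Or.inr rfl)) fun x hx =>
        ((hmem x).1 (hsub hx)).resolve_right fun e => hqG (e ▸ hx)
    · exact key h.ne ((hmem _).2 (Or.inl rfl)) fun x hx =>
        ((hmem x).1 (hsub hx)).resolve_left fun e => hpG (e ▸ hx)
  · exact Finset.card_pair fun e => h.ne (Subtype.ext e)

end MinkowskiVoronoi

/-! ### The canonical diagram -/

namespace MinkowskiVoronoi

variable {S : Set (Fin 3 → ℝ)} {A : GenericAntichain (vrm S)}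

/-- The point of the plane of coordinate sum `0` that represents a triple. -/
def corner (f : vrm S → Fin 3 → ℝ) (t : Fin 3 → vrm S) (i : Fin 3) : ℝ := f (t i) i

/-- A labelling of the complex by the triples and edges of a generic antichain, together with
heights for which all corners are coplanar. -/
structure Layout (A : GenericAntichain (vrm S)) (t : Vertex S → Fin 3 → vrm S)
    (f : vrm S → Fin 3 → ℝ) : Prop where
  nonneg : ∀ x ∈ S, ∀ i, 0 ≤ x i
  g_eq : ∀ p i, A.g p i = perturb p.1 i
  null_iff : ∀ p i, A.Null p i ↔ p.1 i = 0
  isTriple : ∀ v, A.IsTriple (t v)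
  mem_iff : ∀ v x, x ∈ v.1 ↔ ∃ m, x = (t v m).1
  mono : A.IsMono f
  sum_eq : ∀ s, A.IsTriple s → corner f s 0 + corner f s 1 + corner f s 2 = 0

theorem sum_three {i j k : Fin 3} (hij : i ≠ j) (hik : i ≠ k) (hjk : j ≠ k) (X : Fin 3 → ℝ) :
    X i + X j + X k = X 0 + X 1 + X 2 := by
  fin_cases i <;> fin_cases j <;> fin_cases k <;> first | exact absurd rfl ‹_› | (simp; try ring)

namespace Layout

variable {t : Vertex S → Fin 3 → vrm S} {f : vrm S → Fin 3 → ℝ}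

theorem mem_iff' (L : Layout A t f) (v : Vertex S) (p : vrm S) : p.1 ∈ v.1 ↔ ∃ m, p = t v m := by
  rw [L.mem_iff]
  exact exists_congr fun m => ⟨fun e => Subtype.ext e, fun e => congrArg Subtype.val e⟩

theorem injective (L : Layout A t f) : Function.Injective t := by
  intro v w h
  refine Subtype.ext (Finset.ext fun x => ?_)
  rw [L.mem_iff, L.mem_iff, h]

theorem exists_vertex (L : Layout A t f) {s : Fin 3 → vrm S} (hs : A.IsTriple s) :
    ∃ v, t v = s := by
  obtain ⟨v, hv⟩ := exists_vertex_of_isTriple L.nonneg L.g_eq L.null_iff hs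
  refine ⟨v, (L.isTriple v).eq_of_forall_exists hs fun m => ?_⟩
  obtain ⟨n, hn⟩ := (hv _).1 ((L.mem_iff' v _).2 ⟨m, rfl⟩)
  exact ⟨n, Subtype.ext hn⟩

theorem adjacent_iff (L : Layout A t f) {e : Edge S} {p q : vrm S}
    (he : ∀ x, x ∈ e.1 ↔ x = p.1 ∨ x = q.1) (v : Vertex S) :
    e.Adjacent v ↔ (∃ m, p = t v m) ∧ ∃ m, q = t v m := by
  rw [← L.mem_iff', ← L.mem_iff']
  constructor
  · intro h
    exact ⟨h.1 ((he _).2 (Or.inl rfl)), h.1 ((he _).2 (Or.inr rfl))⟩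
  · rintro ⟨h1, h2⟩
    refine Finset.ssubset_iff_subset_ne.2 ⟨fun x hx => ?_, fun h => ?_⟩
    · rcases (he x).1 hx with rfl | rfl <;> assumption
    · have hv : v.1.card = 3 := v.2.2
      have he' : e.1.card = 2 := e.2.2
      rw [h, hv] at he'
      norm_num at he'

theorem coord_pos (L : Layout A t f) (v : Vertex S) :
    coord (embed (corner f (t v))) = corner f (t v) :=
  coord_embed (L.sum_eq _ (L.isTriple v))

theorem joins_of_isFlip (L : Layout A t f) {v w : Vertex S} {i j k : Fin 3}
    (h : A.IsFlip (t v) (t w) i j k) {e : Edge S}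
    (he : ∀ x, x ∈ e.1 ↔ x = (t v j).1 ∨ x = (t v k).1) : e.Joins v w := by
  refine ⟨fun hvw => h.ne (congrArg t hvw), fun u => ?_⟩
  rw [L.adjacent_iff he]
  constructor
  · rintro ⟨h1, h2⟩
    exact (h.eq_or_eq (L.isTriple u) h1 h2).imp (fun e => L.injective e) fun e => L.injective e
  · rintro (rfl | rfl)
    · exact ⟨⟨j, rfl⟩, k, rfl⟩
    · exact ⟨h.exists_eq h.ij.symm, h.exists_eq h.ik.symm⟩

theorem neighbor_of_isFlip (L : Layout A t f) {v w : Vertex S} {i j k : Fin 3}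
    (h : A.IsFlip (t v) (t w) i j k) : v.Neighbor w := by
  obtain ⟨e, he⟩ := exists_edge_of_isEdge L.nonneg L.g_eq L.null_iff (h.left.isEdge h.jk)
  exact ⟨e, L.joins_of_isFlip h he⟩

theorem exists_isFlip_of_neighbor [Finite (vrm S)] (L : Layout A t f) {v w : Vertex S}
    (h : v.Neighbor w) : ∃ i j k, A.IsFlip (t v) (t w) i j k := by
  obtain ⟨e, hvw, hadj⟩ := h
  obtain ⟨p, q, hpq, he⟩ := e.exists_isEdge L.nonneg L.g_eq (A := A)
  have hv := (L.adjacent_iff he v).1 ((hadj v).2 (Or.inl rfl))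
  have hw := (L.adjacent_iff he w).1 ((hadj w).2 (Or.inr rfl))
  by_cases hax : A.IsAxisPoint p ∧ A.IsAxisPoint q
  · obtain ⟨s, i, j, k, -, -, -, -, -, -, -, -, huniq⟩ := hpq.exists_ray hax.1 hax.2
    exact absurd (L.injective ((huniq _ (L.isTriple v) hv.1 hv.2).trans
      (huniq _ (L.isTriple w) hw.1 hw.2).symm)) hvw
  · obtain ⟨s, s', i, j, k, hs, hjk⟩ := hpq.exists_flip hax
    have hmem : ∀ u, (∃ m, p = t u m) ∧ (∃ m, q = t u m) → t u = s ∨ t u = s' := by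
      rintro u ⟨h1, h2⟩
      rcases hjk with ⟨rfl, rfl⟩ | ⟨rfl, rfl⟩
      · exact hs.eq_or_eq (L.isTriple u) h1 h2
      · exact hs.eq_or_eq (L.isTriple u) h2 h1
    rcases hmem v hv with h1 | h1 <;> rcases hmem w hw with h2 | h2
    · exact absurd (L.injective (h1.trans h2.symm)) hvw
    · exact ⟨i, j, k, by rwa [h1, h2]⟩
    · exact ⟨j, i, k, by rw [h1, h2]; exact hs.symm⟩
    · exact absurd (L.injective (h1.trans h2.symm)) hvw

theorem maxCoord_vertex (L : Layout A t f) (v : Vertex S) (i : Fin 3) :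
    maxCoord v.1 i = (t v i).1 i := by
  refine maxCoord_eq ((L.mem_iff v _).2 ⟨i, rfl⟩) fun x hx => ?_
  obtain ⟨m, rfl⟩ := (L.mem_iff v x).1 hx
  refine le_of_perturb_le (L.nonneg _ (t v i).2.1 i) ?_
  rw [← L.g_eq, ← L.g_eq]
  exact (L.isTriple v).le i m

theorem maxCoord_lt_of_isFlip (L : Layout A t f) {v w : Vertex S} {i j k : Fin 3}
    (h : A.IsFlip (t v) (t w) i j k) : maxCoord w.1 i < maxCoord v.1 i := by
  rw [L.maxCoord_vertex, L.maxCoord_vertex, h.eq_left]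
  refine lt_of_perturb_lt (L.nonneg _ (t v i).2.1 i)
    (fun h0 => h.left.not_null i ((L.null_iff _ _).2 h0)) ?_
  rw [← L.g_eq, ← L.g_eq]
  exact h.left.lt i j h.ij.symm

theorem drawnWithLabel_of_isFlip (L : Layout A t f) {v w : Vertex S} {i j k : Fin 3}
    (h : A.IsFlip (t v) (t w) i j k) {l : Fin 6} (hinc : incCoord l = j) (hdec : decCoord l = i)
    (hfix : fixCoord l = k) :
    DrawnWithLabel (fun v => embed (corner f (t v))) v w l := by
  refine ⟨⟨L.neighbor_of_isFlip h, ?_, ?_, ?_⟩,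
    corner f (t w) j - corner f (t v) j, ?_, ?_⟩
  · rw [hinc]; exact L.maxCoord_lt_of_isFlip h.symm
  · rw [hdec]; exact L.maxCoord_lt_of_isFlip h
  · rw [hfix, L.maxCoord_vertex, L.maxCoord_vertex, h.eq_right]
  · have := h.symm.lt L.mono
    rw [h.eq_left] at this
    exact sub_pos.2 this
  · rw [direction_eq, ← embed_smul, hinc, hdec]
    show embed _ - embed _ = _
    rw [embed_sub]
    congr 1
    have hk : corner f (t w) k = corner f (t v) k := by rw [corner, corner, h.eq_right]
    have h1 := L.sum_eq _ (L.isTriple v)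
    have h2 := L.sum_eq _ (L.isTriple w)
    rw [← sum_three h.ij h.ik h.jk] at h1 h2
    funext m
    rcases GenericAntichain.fin_three_cases h.ij h.ik h.jk m with rfl | rfl | rfl
    · simp only [Pi.sub_apply, Pi.smul_apply, smul_eq_mul, Pi.single_eq_same,
        Pi.single_eq_of_ne h.ij]
      linarith
    · simp only [Pi.sub_apply, Pi.smul_apply, smul_eq_mul, Pi.single_eq_same,
        Pi.single_eq_of_ne h.ij.symm]
      linarith
    · simp only [Pi.sub_apply, Pi.smul_apply, smul_eq_mul, Pi.single_eq_of_ne h.ik.symm,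
        Pi.single_eq_of_ne h.jk.symm]
      linarith

/-- The drawing of a finite edge as a segment. -/
theorem exists_segment [Finite (vrm S)] (L : Layout A t f) {e : Edge S} {p q : vrm S}
    (he : ∀ x, x ∈ e.1 ↔ x = p.1 ∨ x = q.1) {s s' : Fin 3 → vrm S} {i j k : Fin 3}
    (hs : A.IsFlip s s' i j k) (hp : s j = p) (hq : s k = q) :
    ∃ v w, e.Joins v w ∧ ∀ P ∈ segment ℝ (embed (corner f (t v))) (embed (corner f (t w))),
      (A.Hex f p (coord P) ∧ A.Hex f q (coord P)) ∧
      ((∃ u, e.Adjacent u ∧ P = embed (corner f (t u))) ∨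
        ∀ u, A.Hex f u (coord P) → u = p ∨ u = q) := by
  obtain ⟨v, rfl⟩ := L.exists_vertex hs.left
  obtain ⟨w, rfl⟩ := L.exists_vertex hs.right
  subst hp hq
  have hjoin := L.joins_of_isFlip hs he
  refine ⟨v, w, hjoin, ?_⟩
  rintro P ⟨a, b, ha, hb, hab, rfl⟩
  have hX : ∀ l, coord (a • embed (corner f (t v)) + b • embed (corner f (t w))) l =
      a * corner f (t v) l + b * corner f (t w) l := fun l => by
    rw [coord_combo, L.coord_pos, L.coord_pos]
  have hcv : ∀ m, A.Hex f (t v m) (corner f (t v)) := L.mono.hex_corner hs.left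
  have hcw : ∀ m, A.Hex f (t w m) (corner f (t w)) := L.mono.hex_corner hs.right
  refine ⟨⟨(hcv j).combo (hs.eq_left ▸ hcw i) ha hb hab hX,
    (hcv k).combo (hs.eq_right ▸ hcw k) ha hb hab hX⟩, ?_⟩
  rcases ha.eq_or_lt with rfl | ha
  · left
    refine ⟨w, (hjoin.2 w).2 (Or.inr rfl), ?_⟩
    rw [zero_add] at hab
    rw [hab, zero_smul, zero_add, one_smul]
  rcases hb.eq_or_lt with rfl | hb
  · left
    refine ⟨v, (hjoin.2 v).2 (Or.inl rfl), ?_⟩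
    rw [add_zero] at hab
    rw [hab, zero_smul, add_zero, one_smul]
  right
  intro u hu
  have hi := hs.lt L.mono
  have hj := hs.symm.lt L.mono
  obtain rfl : a = 1 - b := by linarith
  refine hs.eq_or_eq_of_hex L.mono ?_ ?_ ?_ ?_ ?_ hu
  · rw [hX, corner, corner, hs.eq_left]; nlinarith
  · rw [hX, corner, corner, hs.eq_left]; nlinarith
  · rw [hX, corner, corner]; rw [hs.eq_left] at hj; nlinarith
  · rw [hX, corner, corner]; rw [hs.eq_left] at hj; nlinarith
  · rw [hX, corner, corner, hs.eq_right]; ring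

/-- The drawing of an infinite edge as a ray. -/
theorem exists_ray [Finite (vrm S)] (L : Layout A t f) {e : Edge S} {p q : vrm S}
    (he : ∀ x, x ∈ e.1 ↔ x = p.1 ∨ x = q.1) {s : Fin 3 → vrm S} {i j k : Fin 3}
    (hs : A.IsTriple s) (hij : i ≠ j) (hik : i ≠ k) (hjk : j ≠ k) (hi : s i = A.a i)
    (hk : s k = A.a k) (hj : A.g (s k) j < A.g (s i) j) (hp : s i = p) (hq : s k = q)
    (huniq : ∀ s', A.IsTriple s' → (∃ m, p = s' m) → (∃ m, q = s' m) → s' = s) :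
    ∃ v d, e.InfiniteFrom v ∧ d ≠ 0 ∧ ∀ P ∈ ray (embed (corner f (t v))) d,
      (A.Hex f p (coord P) ∧ A.Hex f q (coord P)) ∧
      ((∃ u, e.Adjacent u ∧ P = embed (corner f (t u))) ∨
        ∀ u, A.Hex f u (coord P) → u = p ∨ u = q) := by
  obtain ⟨v, rfl⟩ := L.exists_vertex hs
  subst hp hq
  have hinf : e.InfiniteFrom v := fun u => by
    rw [L.adjacent_iff he]
    refine ⟨fun h => L.injective (huniq _ (L.isTriple u) h.1 h.2), ?_⟩
    rintro rfl
    exact ⟨⟨i, rfl⟩, k, rfl⟩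
  let D : Fin 3 → ℝ := Pi.single i 1 - Pi.single j 1
  have hDi : D i = 1 := by simp [D, hij]
  have hDj : D j = -1 := by simp [D, hij.symm]
  have hDk : D k = 0 := by simp [D, hik.symm, hjk.symm]
  have hD : coord (embed D) = D := coord_embed (by
    rw [← sum_three hij hik hjk, hDi, hDj, hDk]; norm_num)
  refine ⟨v, embed D, hinf, fun h0 => ?_, ?_⟩
  · have h1 : coord (embed D) i = 1 := by rw [hD, hDi]
    have h2 := coord_combo 0 0 (embed D) (embed D) i
    rw [zero_smul, zero_add, zero_mul, zero_add, ← h0, h1] at h2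
    exact one_ne_zero h2
  · rintro P ⟨τ, hτ, rfl⟩
    have hX : ∀ l, coord (embed (corner f (t v)) + τ • embed D) l =
        corner f (t v) l + τ * D l := fun l => by
      have := coord_combo 1 τ (embed (corner f (t v))) (embed D) l
      rw [one_smul, one_mul] at this
      rw [this, L.coord_pos, hD]
    refine ⟨hs.hex_ray L.mono hij hik hjk hi hk hj ?_ ?_ ?_, ?_⟩
    · rw [hX, hDj, corner]; linarith
    · rw [hX, hDi, corner]; linarith
    · rw [hX, hDk, corner]; ring
    · rcases hτ.eq_or_lt with rfl | hτ
      · exact Or.inl ⟨v, (hinf v).2 rfl, by rw [zero_smul, add_zero]⟩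
      · refine Or.inr fun u hu => hs.eq_or_eq_of_hex_ray L.mono hij hik hjk hi hk ?_ hu
        rw [hX, hDj, corner]; linarith

/-- Every edge can be drawn as required, such that its points lie on the faces of the two points
of the edge, and on no further faces unless they are endpoints of the edge. -/
theorem exists_carrier [Finite (vrm S)] (L : Layout A t f) (e : Edge S) :
    ∃ C : Set Plane,
      ((∃ v w : Vertex S, e.Joins v w ∧
          C = segment ℝ (embed (corner f (t v))) (embed (corner f (t w)))) ∨
        (∃ (v : Vertex S) (d : Plane), e.InfiniteFrom v ∧ d ≠ 0 ∧
          C = ray (embed (corner f (t v))) d)) ∧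
      ∀ P ∈ C, (∀ u : vrm S, u.1 ∈ e.1 → A.Hex f u (coord P)) ∧
        ((∃ u, e.Adjacent u ∧ P = embed (corner f (t u))) ∨
          ∀ u, A.Hex f u (coord P) → u.1 ∈ e.1) := by
  obtain ⟨p, q, hpq, he⟩ := e.exists_isEdge L.nonneg L.g_eq (A := A)
  have he' : ∀ x, x ∈ e.1 ↔ x = q.1 ∨ x = p.1 := fun x => (he x).trans or_comm
  have key : ∀ {p q : vrm S}, (∀ x, x ∈ e.1 ↔ x = p.1 ∨ x = q.1) → ∀ {C : Set Plane},
      (∀ P ∈ C, (A.Hex f p (coord P) ∧ A.Hex f q (coord P)) ∧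
        ((∃ u, e.Adjacent u ∧ P = embed (corner f (t u))) ∨
          ∀ u, A.Hex f u (coord P) → u = p ∨ u = q)) →
      ∀ P ∈ C, (∀ u : vrm S, u.1 ∈ e.1 → A.Hex f u (coord P)) ∧
        ((∃ u, e.Adjacent u ∧ P = embed (corner f (t u))) ∨
          ∀ u, A.Hex f u (coord P) → u.1 ∈ e.1) := by
    intro p q he C hC P hP
    obtain ⟨⟨h1, h2⟩, h3⟩ := hC P hP
    refine ⟨fun u hu => ?_, h3.imp_right fun h u hu => (he _).2 ?_⟩
    · rcases (he _).1 hu with h | h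
      · rwa [Subtype.ext h]
      · rwa [Subtype.ext h]
    · exact (h u hu).imp (congrArg Subtype.val) (congrArg Subtype.val)
  by_cases hax : A.IsAxisPoint p ∧ A.IsAxisPoint q
  · obtain ⟨s, i, j, k, hs, hij, hik, hjk, hi, hk, hj, ⟨h1, h2⟩ | ⟨h1, h2⟩, huniq⟩ :=
      hpq.exists_ray hax.1 hax.2
    · obtain ⟨v, d, hv, hd, hC⟩ := L.exists_ray he hs hij hik hjk hi hk hj h1 h2 huniq
      exact ⟨_, Or.inr ⟨v, d, hv, hd, rfl⟩, key he hC⟩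
    · obtain ⟨v, d, hv, hd, hC⟩ := L.exists_ray he' hs hij hik hjk hi hk hj h1 h2
        fun s' h a b => huniq s' h b a
      exact ⟨_, Or.inr ⟨v, d, hv, hd, rfl⟩, key he' hC⟩
  · obtain ⟨s, s', i, j, k, hs, ⟨h1, h2⟩ | ⟨h1, h2⟩⟩ := hpq.exists_flip hax
    · obtain ⟨v, w, hvw, hC⟩ := L.exists_segment he hs h1 h2
      exact ⟨_, Or.inl ⟨v, w, hvw, rfl⟩, key he hC⟩
    · obtain ⟨v, w, hvw, hC⟩ := L.exists_segment he' hs h1 h2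
      exact ⟨_, Or.inl ⟨v, w, hvw, rfl⟩, key he' hC⟩

theorem hasAllowedType [Finite (vrm S)] (L : Layout A t f) {v : Vertex S}
    (hv : ¬ v.OnInfiniteEdge) : HasAllowedType (fun v => embed (corner f (t v))) v := by
  have hstep : ∀ m : Fin 3, ∃ w j k, A.IsFlip (t v) (t w) m j k := by
    intro m
    obtain ⟨n, l, hnl, hnm, hlm⟩ := GenericAntichain.exists_two_ne m
    by_cases hax : A.IsAxisPoint (t v n) ∧ A.IsAxisPoint (t v l)
    · refine absurd ?_ hv
      have hE := (L.isTriple v).isEdge hnl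
      obtain ⟨e, he⟩ := exists_edge_of_isEdge L.nonneg L.g_eq L.null_iff hE
      obtain ⟨s, i, j, k, -, -, -, -, -, -, -, -, huniq⟩ := hE.exists_ray hax.1 hax.2
      have hvs := huniq _ (L.isTriple v) ⟨n, rfl⟩ ⟨l, rfl⟩
      refine ⟨e, fun u => ?_⟩
      rw [L.adjacent_iff he]
      refine ⟨fun h => L.injective ((huniq _ (L.isTriple u) h.1 h.2).trans hvs.symm), ?_⟩
      rintro rfl
      exact ⟨⟨n, rfl⟩, l, rfl⟩
    · obtain ⟨s, j, k, hs⟩ := (L.isTriple v).exists_flip hnm.symm hlm.symm hnl hax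
      obtain ⟨w, rfl⟩ := L.exists_vertex hs.right
      exact ⟨w, j, k, hs⟩
  choose w j k hw using hstep
  have hlab : ∀ m, ∃ l : Fin 6, incCoord l = j m ∧ decCoord l = m ∧ fixCoord l = k m := fun m =>
    exists_label (hw m).ij (hw m).ik (hw m).jk
  choose l hinc hdec hfix using hlab
  have hdec0 : ∀ l : Fin 6, decCoord l = 0 → l = 0 ∨ l = 1 := by decide
  have hdec1 : ∀ l : Fin 6, decCoord l = 1 → l = 2 ∨ l = 3 := by decide
  have hdec2 : ∀ l : Fin 6, decCoord l = 2 → l = 4 ∨ l = 5 := by decide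
  refine ⟨w, l, fun m n h => ?_, fun u => ⟨fun hu => ?_, ?_⟩, hdec0 _ (hdec 0), hdec1 _ (hdec 1),
    hdec2 _ (hdec 2), fun m => L.drawnWithLabel_of_isFlip (hw m) (hinc m) (hdec m) (hfix m)⟩
  · -- otherwise `t (w m)` would contain all points of `t v`
    by_contra hmn
    refine (hw m).ne ((hw m).left.eq_of_forall_exists (hw m).right fun l => ?_)
    by_cases hl : l = m
    · rw [h]; exact (hw n).exists_eq (hl ▸ hmn)
    · exact (hw m).exists_eq hl
  · obtain ⟨i, a, b, hu⟩ := L.exists_isFlip_of_neighbor hu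
    refine ⟨i, ?_⟩
    rcases hu.eq_or_eq (hw i).right ((hw i).exists_eq hu.ij.symm)
      ((hw i).exists_eq hu.ik.symm) with h | h
    · exact absurd h.symm (hw i).ne
    · exact (L.injective h).symm
  · rintro ⟨m, rfl⟩
    exact L.neighbor_of_isFlip (hw m)

theorem admitsCanonicalDiagram [Finite (vrm S)] (L : Layout A t f) :
    AdmitsCanonicalDiagram S := by
  have hcar := L.exists_carrier
  choose C hlin hC using hcar
  -- the faces at a vertex are those of its three points
  have hvert : ∀ v (u : vrm S), A.Hex f u (coord (embed (corner f (t v)))) → u.1 ∈ v.1 :=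
    fun v u hu => by
      rw [L.coord_pos] at hu
      exact (L.mem_iff' v u).2 (L.mono.exists_eq_of_hex_corner (L.isTriple v) hu)
  have hvert' : ∀ v (u : vrm S), u.1 ∈ v.1 → A.Hex f u (coord (embed (corner f (t v)))) :=
    fun v u hu => by
      obtain ⟨m, rfl⟩ := (L.mem_iff' v u).1 hu
      rw [L.coord_pos]
      exact L.mono.hex_corner (L.isTriple v) m
  -- an edge through a vertex belongs to this vertex
  have hadj : ∀ (v : Vertex S) (e : Edge S), embed (corner f (t v)) ∈ C e → e.Adjacent v := by
    intro v e h
    obtain ⟨p, q, -, he⟩ := e.exists_isEdge L.nonneg L.g_eq (A := A)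
    rw [L.adjacent_iff he, ← L.mem_iff', ← L.mem_iff']
    have hh := (hC e _ h).1
    exact ⟨hvert v p (hh p ((he _).2 (Or.inl rfl))), hvert v q (hh q ((he _).2 (Or.inr rfl)))⟩
  refine ⟨fun v => embed (corner f (t v)), C, hlin, ?_, hadj, ?_, ?_, fun v hv =>
    L.hasAllowedType hv⟩
  · intro v w h
    have h' : embed (corner f (t v)) = embed (corner f (t w)) := h
    refine Subtype.ext (Finset.ext fun x => ⟨fun hx => ?_, fun hx => ?_⟩)
    · exact hvert w ⟨x, v.2.1.1 hx⟩ (h' ▸ hvert' v ⟨x, v.2.1.1 hx⟩ hx)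
    · exact hvert v ⟨x, w.2.1.1 hx⟩ (h' ▸ hvert' w ⟨x, w.2.1.1 hx⟩ hx)
  · rintro e e' hne P ⟨hP, hP'⟩
    rcases (hC e P hP).2 with ⟨u, hu, rfl⟩ | hh
    · exact ⟨u, hu, hadj u e' hP', rfl⟩
    · -- a common point in the interior of `e` would force `e' = e`
      refine absurd (Subtype.ext ?_) hne.symm
      refine Finset.eq_of_subset_of_card_le (fun x hx => ?_) ?_
      · exact hh ⟨x, e'.2.1.1 hx⟩ ((hC e' P hP').1 ⟨x, e'.2.1.1 hx⟩ hx)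
      · rw [show e.1.card = 2 from e.2.2, show e'.1.card = 2 from e'.2.2]
  · intro v w hvw
    obtain ⟨i, j, k, h⟩ := L.exists_isFlip_of_neighbor hvw
    obtain ⟨l, hinc, hdec, hfix⟩ := exists_label h.ij h.ik h.jk
    exact ⟨l, L.drawnWithLabel_of_isFlip h hinc hdec hfix⟩

end Layout

end MinkowskiVoronoi

theorem mainTheorem3 (S : Set (Fin 3 → ℝ)) (hfin : S.Finite)
    (haxial : MinkowskiVoronoi.IsAxial S)
    (hgen : MinkowskiVoronoi.InGeneralPosition S) :
    MinkowskiVoronoi.AdmitsCanonicalDiagram S := by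
  have hV : Finite (MinkowskiVoronoi.vrm S) := (hfin.subset fun _ h => h.1).to_subtype
  obtain ⟨A, hg, hnull⟩ := MinkowskiVoronoi.exists_genericAntichain haxial hgen
  obtain ⟨f, hsum, hmono⟩ := A.exists_coplanar
  have ht := MinkowskiVoronoi.Vertex.exists_isTriple haxial.1 hg
  choose t ht hmem using ht
  exact MinkowskiVoronoi.Layout.admitsCanonicalDiagram (A := A) (t := t) (f := f)
    ⟨haxial.1, hg, hnull, ht, hmem, hmono, hsum⟩
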